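/- Let $G$ be a finite simple graph on the vertices $1,\dots,m$ ($m\ge 1$) with adjacency matrix $H=(h_{ik})$. *Dynamical system.* Let $X(t)=(x_{ij}(t))$ be the real $m\times m$ matrix function with $$x_{ij}''=\sum_{k\ne i}(x_{ij}-x_{kj})\Big(\frac1{\|x_i-x_k\|^2}-h_{ik}\Big),\qquad X(0)=I,\quad X'(0)=0,$$ where $x_i=(x_{i1},\dots,x_{im})$ and the rows $x_1,\dots,x_m$ are pairwise different at all times; $X$ may be considered on $\mathbb R$ or on any open interval $J\ni 0$. Call two rows permutation equivalent if one is a rearrangement of the other. Algorithm A1 puts the vertices $i,j$ into one class iff for every $n$ with $0\le n\le m^2$ the $i$-th and $j$-th rows of the matrix $A_n=\big(x_{ij}^{(2n)}(0)/(2n)!\big)_{i,j}$ are permutation equivalent. *Algorithm A1'.* For an $m\times m$ matrix $T$ (with entries of any kind), let $\mathrm{ren}(T)$ be the matrix of natural numbers obtained by scanning $T$ row by row and replacing each entry that occurred before by the number it got before, and each new entry by the next unused number $0,1,2,\dots$. Define matrices $C^s=(c^s_{ij})$, $D^s=(d^s_{ij})$ for $s\ge 0$ by $c^0_{ij}=0$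 if $i=j$ and $c^0_{ij}=1$ if $i\ne j$; $D^s=\mathrm{ren}(P)$, where $P_{ij}$ is the lexicographically sorted list of the pairs $(c^s_{il},c^s_{jl})$, $1\le l\le m$; and $C^{s+1}=\mathrm{ren}(T)$, where $T_{ij}$ is the lexicographically sorted list of the tuples $(c^s_{ij},c^s_{kj},d^s_{ik},h_{ik})$, $1\le k\le m$. Algorithm A1' computes $C^0,C^1,\dots$ until $C^s=C^{s+1}$, and puts $i,j$ into one class iff for every $s$ with $0\le s\le m^2$ the $i$-th and $j$-th rows of $C^s$ are permutation equivalent. Then: 1. Algorithm A1' is polynomial: there are a program for a random access machine (unit-cost addition, truncated subtraction, comparison and array access on natural numbers) and a polynomial $p$ such that for all $m$ and $G$ the program, given $m$ and $H$, halts after at most $p(m)$ steps, having computed the least $N$ with $C^N=C^{N+1}$, the matrices $C^0,\dots,C^{N+1}$ and the partition of the vertices produced by A1'. 2. The number of steps of A1' is at most $m^2$: the least $N$ with $C^N=C^{N+1}$ exists, $N+1\le m^2$, and $C^s=C^N$ for all $s\ge N$. 3. If $x_{ir}(t)$ and $x_{js}(t)$ are different functions, then there is $k$ with $0\le k\le m^2$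 and $c^k_{ir}\ne c^k_{js}$. 4. A1 is covered by A1': vertices in one class of A1' are in one class of A1, and any two vertices that are mapped to each other by an automorphism of $G$ are in one class of A1'. (So if A1 yields the automorphism partition of $G$, so does A1'.) -/

import Mathlib

namespace GraphDyn

/-! ### The dynamical system -/

/-- The right-hand side `F_H(X)` of the equations of motion: row `i` of `X` is the position of the
`i`-th point, every two points repel each other and adjacent points attract each other. -/
noncomputable def force {m : ℕ} (H X : Matrix (Fin m) (Fin m) ℝ) : Matrix (Fin m) (Fin m) ℝ :=
  fun i j => ∑ k ∈ Finset.univ.erase i,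
    (X i j - X k j) * (1 / (∑ l, (X i l - X k l) ^ 2) - H i k)

/-- `X` solves `X'' = F_H(X)`, `X(0) = I`, `X'(0) = O` on the set of times `J`, with no two points
in the same position at any time. Here `H` is the adjacency matrix of `G`. -/
def IsSolution {m : ℕ} (G : SimpleGraph (Fin m)) [DecidableRel G.Adj] (J : Set ℝ)
    (X : ℝ → Matrix (Fin m) (Fin m) ℝ) : Prop :=
  (∀ t ∈ J, ∀ i k, i ≠ k → X t i ≠ X t k) ∧
  X 0 = 1 ∧
  ∃ Y : ℝ → Matrix (Fin m) (Fin m) ℝ, Y 0 = 0 ∧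
    ∀ t ∈ J, ∀ i j,
      HasDerivAt (fun τ => X τ i j) (Y t i j) t ∧
      HasDerivAt (fun τ => Y τ i j) (force (G.adjMatrix ℝ) (X t) i j) t

/-- Two rows are permutation equivalent if one is a rearrangement of the other. -/
def RowPermEquiv {m : ℕ} {β : Type*} (r₁ r₂ : Fin m → β) : Prop :=
  ∃ π : Equiv.Perm (Fin m), ∀ l, r₁ (π l) = r₂ l

/-- The matrix `A_n` of the coefficients of `t ^ (2 * n)` in the Taylor series of `X` at `0`. -/
noncomputable def coeffMatrix {m : ℕ} (X : ℝ → Matrix (Fin m) (Fin m) ℝ) (n : ℕ) :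
    Matrix (Fin m) (Fin m) ℝ :=
  fun i j => iteratedDeriv (2 * n) (fun t => X t i j) 0 / ((2 * n).factorial : ℝ)

/-- The partition produced by the dynamical algorithm A1. -/
def SameClassA1 {m : ℕ} (X : ℝ → Matrix (Fin m) (Fin m) ℝ) (i j : Fin m) : Prop :=
  ∀ n ≤ m ^ 2, RowPermEquiv (coeffMatrix X n i) (coeffMatrix X n j)

/-! ### The symbolic algorithm A1' -/

/-- All positions `(i, j)` of an `m × m` matrix in row-by-row order. -/
def positions (m : ℕ) : List (Fin m × Fin m) :=
  (List.finRange m).product (List.finRange m)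

/-- The different entries of `T`, in the order in which a row-by-row scan meets them. -/
def scanEntries {m : ℕ} {β : Type*} [DecidableEq β] (T : Fin m → Fin m → β) : List β :=
  (positions m).foldl (fun seen p => if T p.1 p.2 ∈ seen then seen else seen ++ [T p.1 p.2]) []

/-- Replace the entries of `T` by letters in a row-by-row scan: an entry met before gets the letter
that it got before, a new entry gets the next unused letter. The letter with index `n` is coded by
the number `n`. -/
def rename {m : ℕ} {β : Type*} [DecidableEq β] (T : Fin m → Fin m → β) :
    Matrix (Fin m) (Fin m) ℕ :=
  fun i j => (scanEntries T).idxOf (T i j)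

/-- The sorted vector of the pairs `(c_{il}, c_{jl})`. -/
def pairVector {m : ℕ} (C : Matrix (Fin m) (Fin m) ℕ) (i j : Fin m) : List (ℕ ×ₗ ℕ) :=
  ((List.finRange m).map fun l => toLex (C i l, C j l)).insertionSort (· ≤ ·)

/-- The matrix `D^s` computed from `C = C^s`. -/
def distLabels {m : ℕ} (C : Matrix (Fin m) (Fin m) ℕ) : Matrix (Fin m) (Fin m) ℕ :=
  rename (pairVector C)

/-- The sorted vector of the tuples `(c_{ij}, c_{kj}, d_{ik}, h_{ik})`. -/
def tupleVector {m : ℕ} (H C : Matrix (Fin m) (Fin m) ℕ) (i j : Fin m) :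
    List (ℕ ×ₗ ℕ ×ₗ ℕ ×ₗ ℕ) :=
  ((List.finRange m).map fun k =>
    toLex (C i j, toLex (C k j, toLex (distLabels C i k, H i k)))).insertionSort (· ≤ ·)

/-- One step of the algorithm: `C^{s+1}` computed from `C = C^s`. -/
def refine {m : ℕ} (H C : Matrix (Fin m) (Fin m) ℕ) : Matrix (Fin m) (Fin m) ℕ :=
  rename (tupleVector H C)

/-- The matrices `C^s`. -/
def labels {m : ℕ} (G : SimpleGraph (Fin m)) [DecidableRel G.Adj] :
    ℕ → Matrix (Fin m) (Fin m) ℕ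
  | 0 => fun i j => if i = j then 0 else 1
  | s + 1 => refine (G.adjMatrix ℕ) (labels G s)

/-- The algorithm stops at `s`: it is the first index with `C^s = C^{s+1}`. -/
def StopsAt {m : ℕ} (G : SimpleGraph (Fin m)) [DecidableRel G.Adj] (s : ℕ) : Prop :=
  IsLeast {s | labels G s = labels G (s + 1)} s

/-- The partition produced by the symbolic algorithm A1'. -/
def SameClassA1' {m : ℕ} (G : SimpleGraph (Fin m)) [DecidableRel G.Adj] (i j : Fin m) : Prop :=
  ∀ s ≤ m ^ 2, RowPermEquiv (labels G s i) (labels G s j)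

/-! ### Programs with a step count

A random access machine, as a structured language over the natural numbers with scalar variables
and two-dimensional arrays. Every elementary operation costs one step. Addition, truncated
subtraction and comparison are the only operations, so that numbers at most double in a step and
unit costs are polynomially equivalent to Turing machine time. -/

/-- A memory: scalar variables, and arrays with two indices. -/
structure Memory where
  var : ℕ → ℕ
  arr : ℕ → ℕ → ℕ → ℕ

inductive Expr where
  | const (n : ℕ)
  | var (x : ℕ)
  | read (a : ℕ) (e₁ e₂ : Expr)
  | add (e₁ e₂ : Expr)
  | sub (e₁ e₂ : Expr)
  | eq (e₁ e₂ : Expr)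
  | lt (e₁ e₂ : Expr)

def Expr.eval (σ : Memory) : Expr → ℕ
  | .const n => n
  | .var x => σ.var x
  | .read a e₁ e₂ => σ.arr a (e₁.eval σ) (e₂.eval σ)
  | .add e₁ e₂ => e₁.eval σ + e₂.eval σ
  | .sub e₁ e₂ => e₁.eval σ - e₂.eval σ
  | .eq e₁ e₂ => if e₁.eval σ = e₂.eval σ then 1 else 0
  | .lt e₁ e₂ => if e₁.eval σ < e₂.eval σ then 1 else 0

/-- The number of operations performed in the evaluation of an expression. -/
def Expr.cost : Expr → ℕ
  | .const _ => 1
  | .var _ => 1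
  | .read _ e₁ e₂ => e₁.cost + e₂.cost + 1
  | .add e₁ e₂ => e₁.cost + e₂.cost + 1
  | .sub e₁ e₂ => e₁.cost + e₂.cost + 1
  | .eq e₁ e₂ => e₁.cost + e₂.cost + 1
  | .lt e₁ e₂ => e₁.cost + e₂.cost + 1

inductive Program where
  | skip
  | assign (x : ℕ) (e : Expr)
  | store (a : ℕ) (e₁ e₂ e : Expr)
  | seq (p q : Program)
  | ite (e : Expr) (p q : Program)
  | loop (e : Expr) (p : Program)

def Memory.setVar (σ : Memory) (x v : ℕ) : Memory :=
  { σ with var := fun y => if y = x then v else σ.var y }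

def Memory.setArr (σ : Memory) (a u v w : ℕ) : Memory :=
  { σ with arr := fun b i j => if b = a ∧ i = u ∧ j = v then w else σ.arr b i j }

/-- `Exec p σ t τ`: started in memory `σ`, the program `p` halts after exactly `t` steps in
memory `τ`. A condition holds if its value is not `0`. -/
inductive Exec : Program → Memory → ℕ → Memory → Prop
  | skip (σ : Memory) : Exec .skip σ 1 σ
  | assign (x : ℕ) (e : Expr) (σ : Memory) :
      Exec (.assign x e) σ (e.cost + 1) (σ.setVar x (e.eval σ))
  | store (a : ℕ) (e₁ e₂ e : Expr) (σ : Memory) :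
      Exec (.store a e₁ e₂ e) σ (e₁.cost + e₂.cost + e.cost + 1)
        (σ.setArr a (e₁.eval σ) (e₂.eval σ) (e.eval σ))
  | seq {p q : Program} {σ σ₁ σ₂ : Memory} {t₁ t₂ : ℕ} :
      Exec p σ t₁ σ₁ → Exec q σ₁ t₂ σ₂ → Exec (.seq p q) σ (t₁ + t₂) σ₂
  | ite_true {e : Expr} {p q : Program} {σ σ₁ : Memory} {t : ℕ} :
      e.eval σ ≠ 0 → Exec p σ t σ₁ → Exec (.ite e p q) σ (e.cost + 1 + t) σ₁
  | ite_false {e : Expr} {p q : Program} {σ σ₁ : Memory} {t : ℕ} :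
      e.eval σ = 0 → Exec q σ t σ₁ → Exec (.ite e p q) σ (e.cost + 1 + t) σ₁
  | loop_true {e : Expr} {p : Program} {σ σ₁ σ₂ : Memory} {t₁ t₂ : ℕ} :
      e.eval σ ≠ 0 → Exec p σ t₁ σ₁ → Exec (.loop e p) σ₁ t₂ σ₂ →
      Exec (.loop e p) σ (e.cost + 1 + t₁ + t₂) σ₂
  | loop_false {e : Expr} {p : Program} {σ : Memory} :
      e.eval σ = 0 → Exec (.loop e p) σ (e.cost + 1) σ

/-- The input: variable `0` holds the number of vertices and array `0` the adjacency matrix;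
the rest of the memory is `0`. -/
def inputMemory {m : ℕ} (G : SimpleGraph (Fin m)) [DecidableRel G.Adj] : Memory where
  var := fun x => if x = 0 then m else 0
  arr := fun a i j =>
    if h : a = 0 ∧ i < m ∧ j < m then G.adjMatrix ℕ ⟨i, h.2.1⟩ ⟨j, h.2.2⟩ else 0

/-- The output of the algorithm A1': variable `1` holds the index `N` at which it stops, array `1`
the whole run, that is, the matrices `C^0, …, C^{N+1}` (row `s` of the array lists the entries of
`C^s` row by row), and array `2` the partition of the vertices, as a `0`-`1` matrix. -/
def HoldsOutput {m : ℕ} (G : SimpleGraph (Fin m)) [DecidableRel G.Adj] (σ : Memory) : Prop :=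
  StopsAt G (σ.var 1) ∧
  (∀ s ≤ σ.var 1 + 1, ∀ i j : Fin m, σ.arr 1 s (i * m + j) = labels G s i j) ∧
  (∀ i j : Fin m, SameClassA1' G i j → σ.arr 2 i j = 1) ∧
  (∀ i j : Fin m, ¬ SameClassA1' G i j → σ.arr 2 i j = 0)

end GraphDyn

/-!
The set of positions that carry equal labels defines a linear space of matrices: those with equal
entries at equal labels. Once the labelling is stable, this space is invariant under the force,
since the tuple vector at `(i, j)` records, up to a permutation of `k`, everything on which the
force on `x_{ij}` depends; the distances `‖x_i - x_k‖` enter through the labels `d_{ik}`. As the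
space contains the initial values `I` and `O`, uniqueness of solutions keeps the whole solution in
it, so that equal labels force equal component functions. The number of labels grows in every step
until the labelling is stable, and it is at most `m ^ 2`.

For the running time, a letter of a renaming is expressed as the number of first occurrences that
precede it in the scan, and equality of sorted vectors as equality of multiplicities. Both are
bounded counts, which a program evaluates by nested loops over the vertices.
-/

namespace GraphDyn

/-! ### Rearrangements -/

section Rearrangements

variable {m : ℕ} {β : Type*}

theorem rowPermEquiv_iff_map_eq (f g : Fin m → β) :
    RowPermEquiv f g ↔ Finset.univ.val.map f = Finset.univ.val.map g := by
  classical
  constructor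
  · rintro ⟨π, hπ⟩
    obtain rfl : f ∘ π = g := funext hπ
    rw [← Multiset.map_map, Multiset.map_univ_val_equiv]
  · intro h
    have hcard (c : β) : Fintype.card {l // g l = c} = Fintype.card {l // f l = c} := by
      have hcount := congrArg (Multiset.count c) h
      simp only [Multiset.count_map, eq_comm (a := c)] at hcount
      simpa only [Fintype.card_subtype, Finset.card_def, Finset.filter_val] using hcount.symm
    exact ⟨Equiv.ofFiberEquiv fun c => Fintype.equivOfCardEq (hcard c), Equiv.ofFiberEquiv_map _⟩

theorem rowPermEquiv_iff_card [DecidableEq β] (f g : Fin m → β) :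
    RowPermEquiv f g ↔ ∀ l, (Finset.univ.filter fun l' => f l' = f l).card =
      (Finset.univ.filter fun l' => g l' = f l).card := by
  have hcount (f : Fin m → β) (c : β) : Multiset.count c (Finset.univ.val.map f) =
      (Finset.univ.filter fun l' => f l' = c).card := by
    simp only [Multiset.count_map, Finset.card_def, Finset.filter_val, eq_comm (a := c)]
  rw [rowPermEquiv_iff_map_eq]
  refine ⟨fun h l => by rw [← hcount, ← hcount, h], fun h => ?_⟩
  -- Both multisets have `m` elements, so it is enough that the second contains the first.
  refine Multiset.eq_of_le_of_card_le (Multiset.le_iff_count.2 fun c => ?_) (by simp)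
  by_cases hc : c ∈ Finset.univ.val.map f
  · obtain ⟨l, -, rfl⟩ := Multiset.mem_map.1 hc
    rw [hcount, hcount, h]
  · rw [Multiset.count_eq_zero_of_notMem hc]
    exact Nat.zero_le _

theorem insertionSort_map_eq_iff [LinearOrder β] (f g : Fin m → β) :
    ((List.finRange m).map f).insertionSort (· ≤ ·) =
      ((List.finRange m).map g).insertionSort (· ≤ ·) ↔ RowPermEquiv f g := by
  have huniv : (Finset.univ : Finset (Fin m)).val = (List.finRange m : Multiset (Fin m)) := rfl
  rw [rowPermEquiv_iff_map_eq, huniv, Multiset.map_coe, Multiset.map_coe, Multiset.coe_eq_coe]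
  constructor
  · intro h
    exact (List.perm_insertionSort (· ≤ ·) _).symm.trans (h ▸ List.perm_insertionSort _ _)
  · intro h
    exact List.Perm.eq_of_pairwise (fun a b _ _ => le_antisymm)
      (List.pairwise_insertionSort _ _) (List.pairwise_insertionSort _ _)
      (((List.perm_insertionSort _ _).trans h).trans (List.perm_insertionSort _ _).symm)

end Rearrangements

/-! ### Renaming -/

section EraseDups

variable {α β : Type*} [DecidableEq β]

theorem eraseDups_append_singleton (L : List β) (x : β) :
    (L ++ [x]).eraseDups = if x ∈ L then L.eraseDups else L.eraseDups ++ [x] := by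
  rw [List.eraseDups_append]
  split_ifs with h <;> simp [List.removeAll, h, List.eraseDups_cons]

theorem idxOf_eraseDups_append_singleton (L : List β) (x y : β) :
    (L ++ [x]).eraseDups.idxOf y =
      L.eraseDups.idxOf y + if x ∉ L ∧ y ∉ L ∧ x ≠ y then 1 else 0 := by
  rw [eraseDups_append_singleton]
  by_cases hx : x ∈ L
  · simp [hx]
  by_cases hy : y ∈ L.eraseDups
  · rw [if_neg hx, List.idxOf_append_of_mem hy, if_neg fun h => h.2.1 (List.mem_eraseDups.1 hy),
      Nat.add_zero]
  · rw [if_neg hx, List.idxOf_append_of_notMem hy, ← List.idxOf_eq_length hy, List.idxOf_cons]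
    have hyL : y ∉ L := fun h => hy (List.mem_eraseDups.2 h)
    grind

theorem idxOf_eraseDups_map [LinearOrder α] (T : α → β) (y : β) {L : List α}
    (hL : L.Pairwise (· < ·)) :
    (L.map T).eraseDups.idxOf y =
      (L.toFinset.filter fun q => ∀ r ∈ L, r ≤ q → T r ≠ y ∧ (T r = T q → r = q)).card := by
  induction L using List.reverseRecOn with
  | nil => rfl
  | append_singleton L n ih =>
    obtain ⟨hL, -, hlt⟩ := List.pairwise_append.1 hL
    have hlt (r) (hr : r ∈ L) : r < n := hlt r hr n (List.mem_singleton_self n)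
    have hn : n ∉ L := fun h => (hlt n h).false
    have hold : (L.toFinset.filter fun q =>
          ∀ r ∈ L ++ [n], r ≤ q → T r ≠ y ∧ (T r = T q → r = q)) =
        L.toFinset.filter fun q => ∀ r ∈ L, r ≤ q → T r ≠ y ∧ (T r = T q → r = q) := by
      refine Finset.filter_congr fun q hq => ?_
      have hqn : ¬ n ≤ q := (hlt q (List.mem_toFinset.1 hq)).not_ge
      simp [or_imp, forall_and, hqn]
    have hnew : (∀ r ∈ L ++ [n], r ≤ n → T r ≠ y ∧ (T r = T n → r = n)) ↔
        T n ∉ L.map T ∧ y ∉ L.map T ∧ T n ≠ y := by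
      simp only [List.mem_map, List.mem_append, List.mem_singleton]
      grind
    rw [List.map_append, List.map_singleton, idxOf_eraseDups_append_singleton, ih hL,
      List.toFinset_append, List.toFinset_cons, List.toFinset_nil, insert_empty_eq,
      Finset.union_singleton, Finset.filter_insert, hold]
    simp only [hnew]
    split_ifs
    · exact (Finset.card_insert_of_notMem (by simp [hn])).symm
    · rfl

end EraseDups

section Rename

variable {m : ℕ} {β : Type*} [DecidableEq β]

theorem mem_positions (p : Fin m × Fin m) : p ∈ positions m := by
  simp [positions, List.product]

theorem pairwise_lt_positions : ((positions m).map toLex).Pairwise (· < ·) := by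
  have hlt := List.pairwise_lt_finRange m
  rw [List.pairwise_map, positions, List.product, List.pairwise_flatMap]
  simp only [List.pairwise_map, Prod.Lex.toLex_lt_toLex]
  refine ⟨fun i _ => hlt.imp fun h => Or.inr ⟨trivial, h⟩, hlt.imp fun h p hp q hq => Or.inl ?_⟩
  obtain ⟨_, -, rfl⟩ := List.mem_map.1 hp
  obtain ⟨_, -, rfl⟩ := List.mem_map.1 hq
  exact h

theorem scanEntries_eq_eraseDups (T : Fin m → Fin m → β) :
    scanEntries T = ((positions m).map fun p => T p.1 p.2).eraseDups := by
  rw [scanEntries]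
  induction positions m using List.reverseRecOn with
  | nil => rfl
  | append_singleton L p ih =>
    simp only [List.foldl_append, List.foldl_cons, List.foldl_nil, ih, List.map_append,
      List.map_cons, List.map_nil, eraseDups_append_singleton, List.mem_eraseDups]

theorem rename_apply (T : Fin m → Fin m → β) (i j : Fin m) :
    rename T i j = (Finset.univ.filter fun q : Fin m × Fin m => ∀ r : Fin m × Fin m,
      toLex r ≤ toLex q → T r.1 r.2 ≠ T i j ∧ (T r.1 r.2 = T q.1 q.2 → r = q)).card := by
  have h := idxOf_eraseDups_map (fun p : Fin m ×ₗ Fin m => T (ofLex p).1 (ofLex p).2)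
    (T i j) pairwise_lt_positions
  rw [List.map_map] at h
  rw [rename, scanEntries_eq_eraseDups]
  refine h.trans (Finset.card_equiv ofLex fun q => ?_)
  obtain ⟨q, rfl⟩ := toLex.surjective q
  simp [mem_positions]

theorem rename_eq_rename_iff (T : Fin m → Fin m → β) (i j k l : Fin m) :
    rename T i j = rename T k l ↔ T i j = T k l := by
  refine List.idxOf_inj ?_
  rw [scanEntries_eq_eraseDups, List.mem_eraseDups]
  exact List.mem_map_of_mem (mem_positions (i, j))

theorem rename_congr {γ : Type*} [DecidableEq γ] (T : Fin m → Fin m → β) (U : Fin m → Fin m → γ)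
    (h : ∀ i j k l, T i j = T k l ↔ U i j = U k l) : rename T = rename U := by
  funext i j
  simp only [rename_apply, ne_eq, h]

theorem rename_rename (T : Fin m → Fin m → β) : rename (rename T) = rename T :=
  rename_congr _ _ (rename_eq_rename_iff T)

end Rename

/-! ### The labels -/

section Refine

variable {m : ℕ} (H C : Matrix (Fin m) (Fin m) ℕ)

theorem distLabels_eq_iff (i j i' j' : Fin m) :
    distLabels C i j = distLabels C i' j' ↔
      RowPermEquiv (fun l => (C i l, C j l)) (fun l => (C i' l, C j' l)) :=
  (rename_eq_rename_iff _ _ _ _ _).trans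
    (insertionSort_map_eq_iff (fun l => toLex (C i l, C j l)) (fun l => toLex (C i' l, C j' l)))

theorem tupleVector_eq_iff (i j i' j' : Fin m) :
    tupleVector H C i j = tupleVector H C i' j' ↔
      RowPermEquiv (fun k => (C i j, C k j, distLabels C i k, H i k))
        (fun k => (C i' j', C k j', distLabels C i' k, H i' k)) :=
  insertionSort_map_eq_iff
    (fun k => toLex (C i j, toLex (C k j, toLex (distLabels C i k, H i k))))
    (fun k => toLex (C i' j', toLex (C k j', toLex (distLabels C i' k, H i' k))))

theorem refine_eq_iff (i j i' j' : Fin m) :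
    refine H C i j = refine H C i' j' ↔
      RowPermEquiv (fun k => (C i j, C k j, distLabels C i k, H i k))
        (fun k => (C i' j', C k j', distLabels C i' k, H i' k)) :=
  (rename_eq_rename_iff _ _ _ _ _).trans (tupleVector_eq_iff H C i j i' j')

variable {H C}

theorem eq_of_refine_eq {i j i' j' : Fin m} (h : refine H C i j = refine H C i' j') :
    C i j = C i' j' := by
  obtain ⟨π, hπ⟩ := (refine_eq_iff H C i j i' j').1 h
  exact congrArg Prod.fst (hπ i)

theorem refine_perm_apply {π : Equiv.Perm (Fin m)} (hH : ∀ i k, H (π i) (π k) = H i k)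
    (hC : ∀ i j, C (π i) (π j) = C i j) (i j : Fin m) :
    refine H C (π i) (π j) = refine H C i j := by
  have hD (k : Fin m) : distLabels C (π i) (π k) = distLabels C i k :=
    (distLabels_eq_iff C _ _ _ _).2 ⟨π, fun l => Prod.ext (hC i l) (hC k l)⟩
  exact (refine_eq_iff H C _ _ _ _).2
    ⟨π, fun k => Prod.ext (hC i j) (Prod.ext (hC k j) (Prod.ext (hD k) (hH i k)))⟩

end Refine

theorem card_image_lt_card_image {α β γ : Type*} [Fintype α] [DecidableEq β] [DecidableEq γ]
    {f : α → β} {g : α → γ} (hfg : ∀ a b, g a = g b → f a = f b) {a b : α} (hf : f a = f b)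
    (hg : g a ≠ g b) : (Finset.univ.image f).card < (Finset.univ.image g).card := by
  let φ : γ → β := Function.extend g f fun _ => f a
  have hφ (c : α) : φ (g c) = f c := Function.FactorsThrough.extend_apply (hfg · · ·) _ c
  have himage : Finset.univ.image f = (Finset.univ.image g).image φ := by
    rw [Finset.image_image]
    exact Finset.image_congr fun c _ => (hφ c).symm
  rw [himage]
  refine Finset.card_image_le.lt_of_ne fun hcard => hg ?_
  refine Finset.card_image_iff.1 hcard (by simp) (by simp) ?_
  rw [hφ, hφ, hf]

theorem exists_isLeast_eq_succ {α : Type*} {C : ℕ → α} {count : ℕ → ℕ} {b : ℕ}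
    (hlt : ∀ s, C s ≠ C (s + 1) → count s < count (s + 1)) (hb : ∀ s, count s ≤ b) :
    ∃ N, IsLeast {s | C s = C (s + 1)} N ∧ count 0 + N ≤ b := by
  classical
  have hgrowth (k : ℕ) (hk : ∀ s < k, C s ≠ C (s + 1)) : count 0 + k ≤ count k := by
    induction k with
    | zero => rfl
    | succ k ih =>
      exact (ih fun s hs => hk s (by lia)).trans_lt (hlt k (hk k k.lt_succ_self))
  have hex : ∃ N, C N = C (N + 1) := by
    by_contra! hne
    have := (hgrowth (b + 1) fun s _ => hne s).trans (hb _)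
    lia
  exact ⟨Nat.find hex, ⟨Nat.find_spec hex, fun s hs => Nat.find_min' hex hs⟩,
    (hgrowth _ fun s hs => Nat.find_min hex hs).trans (hb _)⟩

section Labels

variable {m : ℕ} (G : SimpleGraph (Fin m)) [DecidableRel G.Adj]

theorem rename_labels_zero : rename (labels G 0) = labels G 0 := by
  funext i j
  refine (rename_apply (labels G 0) i j).trans ?_
  have : NeZero m := ⟨by rintro rfl; exact i.elim0⟩
  have h00 : labels G 0 0 0 = 0 := by simp [labels]
  have hle (q : Fin m × Fin m) : toLex ((0, 0) : Fin m × Fin m) ≤ toLex q := by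
    simp [Prod.Lex.toLex_le_toLex, (Fin.zero_le q.1).lt_or_eq]
  by_cases hij : i = j
  · have hlabel : labels G 0 i j = 0 := if_pos hij
    rw [hlabel, Finset.card_eq_zero, Finset.filter_eq_empty_iff]
    exact fun q _ hq => (hq (0, 0) (hle q)).1 h00
  · have hlabel : labels G 0 i j = 1 := if_neg hij
    rw [hlabel, Finset.card_eq_one]
    refine ⟨(0, 0), Finset.eq_singleton_iff_unique_mem.2 ⟨?_, fun q hq => ?_⟩⟩
    · refine Finset.mem_filter.2 ⟨Finset.mem_univ _, fun r hr => ?_⟩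
      obtain rfl : r = (0, 0) := toLex.injective (hr.antisymm (hle r))
      exact ⟨h00 ▸ zero_ne_one, fun _ => rfl⟩
    · have hq := (Finset.mem_filter.1 hq).2
      have hq1 : labels G 0 q.1 q.2 ≠ 1 := (hq q le_rfl).1
      have hq0 : labels G 0 q.1 q.2 = 0 := by
        simp only [labels] at hq1 ⊢
        split_ifs at hq1 ⊢ <;> first | rfl | contradiction
      exact ((hq (0, 0) (hle q)).2 (h00.trans hq0.symm)).symm

theorem rename_labels (s : ℕ) : rename (labels G s) = labels G s := by
  cases s with
  | zero => exact rename_labels_zero G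
  | succ s => exact rename_rename _

variable {G}

theorem labels_eq_of_le {s t : ℕ} (hst : s ≤ t) {i j i' j' : Fin m}
    (h : labels G t i j = labels G t i' j') : labels G s i j = labels G s i' j' := by
  induction t, hst using Nat.le_induction with
  | base => exact h
  | succ t _ ih => exact ih (eq_of_refine_eq h)

variable (G) in
/-- The number of different labels in `C^s`, which grows until the algorithm stops. -/
def labelCount (s : ℕ) : ℕ :=
  (Finset.univ.image fun p : Fin m × Fin m => labels G s p.1 p.2).card

theorem labelCount_lt_succ {s : ℕ} (h : labels G s ≠ labels G (s + 1)) :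
    labelCount G s < labelCount G (s + 1) := by
  obtain ⟨i, j, i', j', heq, hne⟩ : ∃ i j i' j', labels G s i j = labels G s i' j' ∧
      labels G (s + 1) i j ≠ labels G (s + 1) i' j' := by
    by_contra! hsplit
    apply h
    rw [← rename_labels G s, ← rename_labels G (s + 1)]
    exact rename_congr _ _ fun i j i' j' => ⟨hsplit i j i' j', eq_of_refine_eq⟩
  exact card_image_lt_card_image (f := fun p : Fin m × Fin m => labels G s p.1 p.2)
    (fun _ _ => eq_of_refine_eq) (a := (i, j)) (b := (i', j')) heq hne

theorem labelCount_le (s : ℕ) : labelCount G s ≤ m ^ 2 :=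
  Finset.card_image_le.trans (by simp [sq])

theorem labelCount_pos (hm : 0 < m) (s : ℕ) : 0 < labelCount G s :=
  have : Nonempty (Fin m) := ⟨0, hm⟩
  Finset.card_pos.2 (Finset.univ_nonempty.image _)

variable (G) in
theorem exists_stopsAt : ∃ N, StopsAt G N ∧ labelCount G 0 + N ≤ m ^ 2 :=
  exists_isLeast_eq_succ (fun _ => labelCount_lt_succ) labelCount_le

theorem StopsAt.eq {N : ℕ} (hN : StopsAt G N) {s : ℕ} (hs : N ≤ s) : labels G s = labels G N := by
  induction s, hs using Nat.le_induction with
  | base => rfl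
  | succ s _ ih => rw [labels, ih]; exact hN.1.symm

theorem labels_automorphism (φ : G ≃g G) (s : ℕ) (i j : Fin m) :
    labels G s (φ i) (φ j) = labels G s i j := by
  induction s generalizing i j with
  | zero => simp [labels]
  | succ s ih =>
    exact refine_perm_apply (π := φ.toEquiv)
      (fun i k => by simp [SimpleGraph.adjMatrix_apply, φ.map_adj_iff]) ih i j

theorem sameClassA1'_of_automorphism {i j : Fin m} (h : ∃ φ : G ≃g G, φ i = j) :
    SameClassA1' G i j := by
  obtain ⟨φ, rfl⟩ := h
  refine fun s _ => ⟨φ.symm.toEquiv, fun l => ?_⟩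
  rw [← labels_automorphism φ]
  exact congrArg _ (φ.apply_symm_apply l)

theorem sameClassA1'_iff {N : ℕ} (hN : StopsAt G N) (hle : N ≤ m ^ 2) (i j : Fin m) :
    SameClassA1' G i j ↔ RowPermEquiv (labels G N i) (labels G N j) := by
  refine ⟨fun h => h N hle, fun ⟨π, hπ⟩ s _ => ⟨π, fun l => ?_⟩⟩
  rcases le_total s N with h | h
  · exact labels_eq_of_le h (hπ l)
  · rw [hN.eq h, hπ]

end Labels

/-! ### Invariant subspaces of differential equations -/

section Invariance

open Topology

variable {E : Type*} [NormedAddCommGroup E] [NormedSpace ℝ E] {S : Submodule ℝ E} {V : E → E}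
  {z : ℝ → E}

theorem eventually_mem_of_hasDerivAt (hS : S.ClosedComplemented) (hV : ∀ x ∈ S, V x ∈ S) {t₀ : ℝ}
    (hz : ∀ᶠ t in 𝓝 t₀, HasDerivAt z (V (z t)) t)
    (hLip : ∃ K, ∃ U ∈ 𝓝 (z t₀), LipschitzOnWith K V U) (hmem : z t₀ ∈ S) :
    ∀ᶠ t in 𝓝 t₀, z t ∈ S := by
  obtain ⟨P, hP⟩ := hS
  obtain ⟨K, U, hU, hVU⟩ := hLip
  let Q : E →L[ℝ] E := S.subtypeL ∘L P
  have hQ {x : E} (hx : x ∈ S) : Q x = x := congrArg Subtype.val (hP ⟨x, hx⟩)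
  have hQS (x : E) : Q x ∈ S := (P x).2
  let R : E →L[ℝ] E := ContinuousLinearMap.id ℝ E - Q
  have hQR (x : E) : Q x + R x = x := by simp [R]
  have hR {x : E} (hx : x ∈ S) : R x = 0 := by simp [R, hQ hx]
  -- `z` and its projection `Q ∘ z` solve the same equation, as `R ∘ V` vanishes on `S`.
  let v : ℝ → E → E := fun t x => Q (V (z t)) + R (V x)
  have hvLip (t : ℝ) : LipschitzOnWith (0 + ‖R‖₊ * K) (v t) U :=
    (LipschitzWith.const (Q (V (z t)))).lipschitzOnWith.add (R.lipschitz.comp_lipschitzOnWith hVU)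
  have hcont : ContinuousAt z t₀ := hz.self_of_nhds.continuousAt
  have hQz₀ : Q (z t₀) = z t₀ := hQ hmem
  have hQU : ∀ᶠ t in 𝓝 t₀, Q (z t) ∈ U :=
    (Q.continuous.continuousAt.comp hcont).eventually_mem (by rwa [Function.comp_apply, hQz₀])
  have hzv : ∀ᶠ t in 𝓝 t₀, HasDerivAt z (v t (z t)) t ∧ z t ∈ U := by
    filter_upwards [hz, hcont.eventually_mem hU] with t ht htU
    exact ⟨ht.congr_deriv (hQR (V (z t))).symm, htU⟩
  have hQzv : ∀ᶠ t in 𝓝 t₀, HasDerivAt (fun t => Q (z t)) (v t (Q (z t))) t ∧ Q (z t) ∈ U := by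
    filter_upwards [hz, hQU] with t ht htU
    have hv : v t (Q (z t)) = Q (V (z t)) := by simp only [v, hR (hV _ (hQS _)), add_zero]
    exact ⟨hv ▸ Q.hasFDerivAt.comp_hasDerivAt t ht, htU⟩
  filter_upwards [ODE_solution_unique_of_eventually (.of_forall hvLip) hzv hQzv hQz₀.symm]
    with t ht
  exact ht ▸ hQS (z t)

theorem mem_of_hasDerivAt (hS : S.ClosedComplemented) (hV : ∀ x ∈ S, V x ∈ S) {J : Set ℝ}
    (hJ : IsOpen J) (hJc : IsPreconnected J) (hz : ∀ t ∈ J, HasDerivAt z (V (z t)) t)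
    (hLip : ∀ t ∈ J, ∃ K, ∃ U ∈ 𝓝 (z t), LipschitzOnWith K V U) {t₀ : ℝ} (ht₀ : t₀ ∈ J)
    (hmem : z t₀ ∈ S) : ∀ t ∈ J, z t ∈ S := by
  have hlocal {t : ℝ} (ht : t ∈ J) (hzt : z t ∈ S) : ∀ᶠ τ in 𝓝 t, z τ ∈ S :=
    eventually_mem_of_hasDerivAt hS hV (Filter.eventually_of_mem (hJ.mem_nhds ht) hz)
      (hLip t ht) hzt
  have hsub : J ⊆ {t | ∀ᶠ τ in 𝓝 t, z τ ∈ S} := by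
    refine hJc.subset_of_closure_inter_subset isOpen_setOfPred_eventually_nhds
      ⟨t₀, ht₀, hlocal ht₀ hmem⟩ fun t ⟨htcl, ht⟩ => hlocal ht ?_
    rw [← SetLike.mem_coe, ← hS.isClosed.closure_eq]
    exact (hz t ht).continuousAt.continuousWithinAt.mem_closure htcl
      fun τ hτ => Filter.Eventually.self_of_nhds (p := fun τ => z τ ∈ S) hτ
  exact fun t ht => (hsub ht).self_of_nhds

end Invariance

/-! ### Components of the solution with equal labels -/

section Solution

variable {m : ℕ}

/-- The matrices with equal entries at positions with equal labels: the subspace that the solution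
cannot leave when the labelling is stable. -/
def labelSubspace (C : Matrix (Fin m) (Fin m) ℕ) : Submodule ℝ (Fin m → Fin m → ℝ) where
  carrier := {X | ∀ i j i' j', C i j = C i' j' → X i j = X i' j'}
  add_mem' hX hY i j i' j' h := congrArg₂ (· + ·) (hX i j i' j' h) (hY i j i' j' h)
  zero_mem' _ _ _ _ _ := rfl
  smul_mem' a _ hX i j i' j' h := congrArg (a * ·) (hX i j i' j' h)

theorem force_apply_eq_of_refine_eq {H C : Matrix (Fin m) (Fin m) ℕ}
    {X : Matrix (Fin m) (Fin m) ℝ} (hX : X ∈ labelSubspace C) {i j i' j' : Fin m}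
    (h : refine H C i j = refine H C i' j') :
    force (H.map Nat.cast) X i j = force (H.map Nat.cast) X i' j' := by
  have hforce (i j : Fin m) : force (H.map Nat.cast) X i j =
      ∑ k, (X i j - X k j) * (1 / (∑ l, (X i l - X k l) ^ 2) - H i k) := by
    rw [force, ← Finset.add_sum_erase _ _ (Finset.mem_univ i)]
    simp
  obtain ⟨π, hπ⟩ := (refine_eq_iff H C i j i' j').1 h
  rw [hforce, hforce, ← Equiv.sum_comp π]
  refine Finset.sum_congr rfl fun k _ => ?_
  obtain ⟨hij, hkj, hD, hH⟩ : C i j = C i' j' ∧ C (π k) j = C k j' ∧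
      distLabels C i (π k) = distLabels C i' k ∧ H i (π k) = H i' k := by simpa using hπ k
  have hdist : ∑ l, (X i l - X (π k) l) ^ 2 = ∑ l, (X i' l - X k l) ^ 2 := by
    obtain ⟨ρ, hρ⟩ := (distLabels_eq_iff C _ _ _ _).1 hD
    rw [← Equiv.sum_comp ρ]
    refine Finset.sum_congr rfl fun l _ => ?_
    obtain ⟨hil, hkl⟩ := Prod.ext_iff.1 (hρ l)
    rw [hX _ _ _ _ hil, hX _ _ _ _ hkl]
  rw [hdist, hH, hX _ _ _ _ hij, hX _ _ _ _ hkj]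

theorem contDiffAt_force (H : Matrix (Fin m) (Fin m) ℝ) {X : Fin m → Fin m → ℝ}
    (hX : ∀ i k, i ≠ k → X i ≠ X k) :
    ContDiffAt ℝ 1 (E := Fin m → Fin m → ℝ) (F := Fin m → Fin m → ℝ) (force H) X := by
  have hentry (i j : Fin m) : ContDiffAt ℝ 1 (fun X : Fin m → Fin m → ℝ => X i j) X :=
    (contDiff_apply_apply ℝ ℝ i j).contDiffAt
  change ContDiffAt ℝ 1 (fun (X : Fin m → Fin m → ℝ) (i j : Fin m) =>
    ∑ k ∈ Finset.univ.erase i, (X i j - X k j) * (1 / (∑ l, (X i l - X k l) ^ 2) - H i k)) X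
  refine contDiffAt_pi.2 fun i => contDiffAt_pi.2 fun j => ContDiffAt.sum fun k hk => ?_
  have hdist : ∑ l, (X i l - X k l) ^ 2 ≠ 0 := by
    intro h0
    rw [Finset.sum_eq_zero_iff_of_nonneg fun l _ => sq_nonneg _] at h0
    exact hX i k (Finset.ne_of_mem_erase hk).symm <| funext fun l =>
      sub_eq_zero.1 (pow_eq_zero_iff two_ne_zero |>.1 (h0 l (Finset.mem_univ l)))
  refine ((hentry i j).sub (hentry k j)).mul (ContDiffAt.sub ?_ contDiffAt_const)
  exact contDiffAt_const.div
    (ContDiffAt.sum fun l _ => ((hentry i l).sub (hentry k l)).pow 2) hdist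

variable {G : SimpleGraph (Fin m)} [DecidableRel G.Adj] {N : ℕ}

theorem one_mem_labelSubspace (s : ℕ) :
    (1 : Matrix (Fin m) (Fin m) ℝ) ∈ labelSubspace (labels G s) := by
  intro i j i' j' h
  have h0 := labels_eq_of_le (Nat.zero_le s) h
  simp only [labels] at h0
  change (1 : Matrix _ _ ℝ) i j = (1 : Matrix _ _ ℝ) i' j'
  rw [Matrix.one_apply, Matrix.one_apply]
  split_ifs at h0 ⊢ <;> simp_all

theorem force_mem_labelSubspace (hN : StopsAt G N) {X : Fin m → Fin m → ℝ}
    (hX : X ∈ labelSubspace (labels G N)) :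
    force (G.adjMatrix ℝ) X ∈ labelSubspace (labels G N) := by
  have hcast : G.adjMatrix ℝ = (G.adjMatrix ℕ).map Nat.cast := by
    ext i j
    simp [SimpleGraph.adjMatrix_apply]
  intro i j i' j' h
  rw [hcast]
  have hsucc : labels G N = refine (G.adjMatrix ℕ) (labels G N) := hN.1
  exact force_apply_eq_of_refine_eq hX (hsucc ▸ h)

theorem solution_mem_labelSubspace (hN : StopsAt G N) {J : Set ℝ} (hJ : IsOpen J)
    (hJc : J.OrdConnected) (h0 : (0 : ℝ) ∈ J) {X : ℝ → Matrix (Fin m) (Fin m) ℝ}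
    (hX : IsSolution G J X) : ∀ t ∈ J, X t ∈ labelSubspace (labels G N) := by
  obtain ⟨hne, hX0, Y, hY0, hXY⟩ := hX
  let E := Fin m → Fin m → ℝ
  let S : Submodule ℝ (E × E) := (labelSubspace (labels G N)).prod (labelSubspace (labels G N))
  let V : E × E → E × E := fun z => (z.2, force (G.adjMatrix ℝ) z.1)
  let z : ℝ → E × E := fun t => (X t, Y t)
  have hV (x : E × E) (hx : x ∈ S) : V x ∈ S := ⟨hx.2, force_mem_labelSubspace hN hx.1⟩
  have hz (t : ℝ) (ht : t ∈ J) : HasDerivAt z (V (z t)) t :=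
    .prodMk (hasDerivAt_pi.2 fun i => hasDerivAt_pi.2 fun j => (hXY t ht i j).1)
      (hasDerivAt_pi.2 fun i => hasDerivAt_pi.2 fun j => (hXY t ht i j).2)
  have hVdiff (t : ℝ) (ht : t ∈ J) : ContDiffAt ℝ 1 V (z t) :=
    contDiffAt_snd.prodMk
      (ContDiffAt.comp (z t) (contDiffAt_force (G.adjMatrix ℝ) (hne t ht)) contDiffAt_fst)
  have hmem : z 0 ∈ S := by
    simp only [z, hX0, hY0]
    exact ⟨one_mem_labelSubspace N, zero_mem _⟩
  exact fun t ht => (mem_of_hasDerivAt (.of_finiteDimensional S) hV hJ hJc.isPreconnected hz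
    (fun t ht => (hVdiff t ht).exists_lipschitzOnWith) h0 hmem t ht).1

end Solution

/-! ### Total correctness with a time bound -/

section Programs

theorem Memory.setVar_var (σ : Memory) (x v y : ℕ) :
    (σ.setVar x v).var y = if y = x then v else σ.var y := rfl

/-- Total correctness: started in `σ`, the program halts after at most `T` steps in a memory that
satisfies `Q`. -/
def Program.HaltsWithin (prog : Program) (T : ℕ) (σ : Memory) (Q : Memory → Prop) : Prop :=
  ∃ t τ, Exec prog σ t τ ∧ t ≤ T ∧ Q τ

variable {p q : Program} {T T₁ T₂ n x : ℕ} {σ : Memory} {Q R : Memory → Prop} {e : Expr}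

theorem Program.HaltsWithin.mono (h : p.HaltsWithin T₁ σ R) (hT : T₁ ≤ T₂)
    (hQ : ∀ τ, R τ → Q τ) : p.HaltsWithin T₂ σ Q := by
  obtain ⟨t, τ, hexec, ht, hR⟩ := h
  exact ⟨t, τ, hexec, ht.trans hT, hQ τ hR⟩

theorem haltsWithin_assign (h : Q (σ.setVar x (e.eval σ))) :
    (Program.assign x e).HaltsWithin (e.cost + 1) σ Q :=
  ⟨_, _, .assign x e σ, le_rfl, h⟩

theorem haltsWithin_store {a : ℕ} {e₁ e₂ : Expr}
    (h : Q (σ.setArr a (e₁.eval σ) (e₂.eval σ) (e.eval σ))) :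
    (Program.store a e₁ e₂ e).HaltsWithin (e₁.cost + e₂.cost + e.cost + 1) σ Q :=
  ⟨_, _, .store a e₁ e₂ e σ, le_rfl, h⟩

theorem Program.HaltsWithin.seq (hp : p.HaltsWithin T₁ σ R)
    (hq : ∀ τ, R τ → q.HaltsWithin T₂ τ Q) : (Program.seq p q).HaltsWithin (T₁ + T₂) σ Q := by
  obtain ⟨t₁, σ₁, hexec₁, ht₁, hR⟩ := hp
  obtain ⟨t₂, σ₂, hexec₂, ht₂, hQ⟩ := hq σ₁ hR
  exact ⟨_, σ₂, .seq hexec₁ hexec₂, Nat.add_le_add ht₁ ht₂, hQ⟩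

theorem haltsWithin_loop {I : ℕ → Memory → Prop}
    (hbody : ∀ k < n, ∀ σ, I k σ → e.eval σ ≠ 0 ∧ p.HaltsWithin T σ (I (k + 1)))
    (hexit : ∀ σ, I n σ → e.eval σ = 0) (h0 : I 0 σ) :
    (Program.loop e p).HaltsWithin (n * (e.cost + 1 + T) + (e.cost + 1)) σ (I n) := by
  suffices hrest : ∀ r ≤ n, ∀ σ, I (n - r) σ →
      (Program.loop e p).HaltsWithin (r * (e.cost + 1 + T) + (e.cost + 1)) σ (I n) from
    hrest n le_rfl σ ((Nat.sub_self n).symm ▸ h0)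
  intro r
  induction r with
  | zero => exact fun _ σ hσ => ⟨_, σ, .loop_false (hexit σ hσ), by omega, hσ⟩
  | succ r ih =>
    intro hr σ hσ
    obtain ⟨hcond, t₁, σ₁, hexec₁, ht₁, hσ₁⟩ := hbody (n - (r + 1)) (by omega) σ hσ
    rw [show n - (r + 1) + 1 = n - r by omega] at hσ₁
    obtain ⟨t₂, σ₂, hexec₂, ht₂, hσ₂⟩ := ih (by omega) σ₁ hσ₁
    refine ⟨_, σ₂, .loop_true hcond hexec₁ hexec₂, ?_, hσ₂⟩
    rw [Nat.succ_mul]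
    omega

/-- The loop `for x < var 0 do body`, whose body has to leave `x` alone. -/
def Program.forLoop (x : ℕ) (body : Program) : Program :=
  .seq (.assign x (.const 0))
    (.loop (.lt (.var x) (.var 0)) (.seq body (.assign x (.add (.var x) (.const 1)))))

theorem haltsWithin_forLoop {I : ℕ → Memory → Prop} (hn : ∀ k σ, I k σ → σ.var 0 = n)
    (hI : ∀ k σ v, I k σ → I k (σ.setVar x v))
    (hbody : ∀ k < n, ∀ σ, I k σ → σ.var x = k →
      p.HaltsWithin T σ fun τ => I (k + 1) τ ∧ τ.var x = k) (h0 : I 0 σ) :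
    (Program.forLoop x p).HaltsWithin (n * (T + 8) + 6) σ (I n) := by
  have hinit : (Program.assign x (.const 0)).HaltsWithin 2 σ fun τ => I 0 τ ∧ τ.var x = 0 :=
    haltsWithin_assign ⟨hI 0 σ _ h0, if_pos rfl⟩
  refine (hinit.seq fun τ hτ => haltsWithin_loop (n := n) (I := fun k τ => I k τ ∧ τ.var x = k)
    (T := T + 4) (fun k hk ρ ⟨hρ, hρx⟩ => ⟨?_, ?_⟩) (fun ρ ⟨hρ, hρx⟩ => ?_) hτ).mono ?_
    fun _ h => h.1
  · simp [Expr.eval, hρx, hn k ρ hρ, hk]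
  · refine (hbody k hk ρ hρ hρx).seq fun τ ⟨hτ, hτx⟩ => haltsWithin_assign ⟨hI _ _ _ hτ, ?_⟩
    simp [Memory.setVar_var, Expr.eval, hτx]
  · simp [Expr.eval, hρx, hn n ρ hρ]
  · simp only [Expr.cost]
    apply le_of_eq
    ring

/-- A `forLoop` that saves `x` in `y` and restores it at the end, because `x` may be in use. -/
def Program.localForLoop (x y : ℕ) (body : Program) : Program :=
  .seq (.assign y (.var x)) (.seq (.forLoop x body) (.assign x (.var y)))

theorem haltsWithin_localForLoop {y : ℕ} {I : ℕ → Memory → Prop} (hxy : y ≠ x)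
    (hn : ∀ k σ, I k σ → σ.var 0 = n)
    (hI : ∀ k σ z v, z = x ∨ z = y → I k σ → I k (σ.setVar z v))
    (hbody : ∀ k < n, ∀ σ, I k σ → σ.var x = k →
      p.HaltsWithin T σ fun τ => I (k + 1) τ ∧ τ.var x = k ∧ τ.var y = σ.var y) (h0 : I 0 σ) :
    (Program.localForLoop x y p).HaltsWithin (n * (T + 8) + 10) σ
      fun τ => I n τ ∧ τ.var x = σ.var x := by
  have hsave : (Program.assign y (.var x)).HaltsWithin 2 σ fun τ => I 0 τ ∧ τ.var y = σ.var x :=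
    haltsWithin_assign ⟨hI 0 σ y _ (.inr rfl) h0, if_pos rfl⟩
  refine (hsave.seq fun σ₁ h₁ => .seq (haltsWithin_forLoop (T := T)
      (I := fun k τ => I k τ ∧ τ.var y = σ.var x) (fun k ρ hρ => hn k ρ hρ.1) ?_ ?_ h₁)
      fun σ₂ h₂ => haltsWithin_assign ⟨hI n σ₂ x _ (.inl rfl) h₂.1, ?_⟩).mono ?_ fun _ h => h
  · exact fun k ρ v hρ => ⟨hI k ρ x v (.inl rfl) hρ.1, (if_neg hxy).trans hρ.2⟩
  · exact fun k hk ρ hρ hρx => (hbody k hk ρ hρ.1 hρx).mono le_rfl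
      fun τ hτ => ⟨⟨hτ.1, hτ.2.2.trans hρ.2⟩, hτ.2.1⟩
  · simp only [Expr.cost]
    omega
  · exact (if_pos rfl).trans h₂.2

end Programs

/-! ### Functions that are computable in polynomial time -/

/-- The memory `τ` differs from `σ` only in variables from `d` on: what a subroutine may change if
it uses these variables as its workspace. -/
def Memory.AgreesBelow (d : ℕ) (σ τ : Memory) : Prop :=
  τ.arr = σ.arr ∧ ∀ x < d, τ.var x = σ.var x

theorem Memory.AgreesBelow.refl (d : ℕ) (σ : Memory) : σ.AgreesBelow d σ :=
  ⟨rfl, fun _ _ => rfl⟩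

theorem Memory.AgreesBelow.trans {d : ℕ} {σ τ ρ : Memory} (h : σ.AgreesBelow d τ)
    (h' : τ.AgreesBelow d ρ) : σ.AgreesBelow d ρ :=
  ⟨h'.1.trans h.1, fun x hx => (h'.2 x hx).trans (h.2 x hx)⟩

theorem Memory.AgreesBelow.mono {d d' : ℕ} {σ τ : Memory} (h : σ.AgreesBelow d' τ) (hd : d ≤ d') :
    σ.AgreesBelow d τ :=
  ⟨h.1, fun x hx => h.2 x (hx.trans_le hd)⟩

theorem Memory.AgreesBelow.setVar {d x : ℕ} {σ τ : Memory} (h : σ.AgreesBelow d τ) (hx : d ≤ x)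
    (v : ℕ) : σ.AgreesBelow d (τ.setVar x v) :=
  ⟨h.1, fun y hy => (if_neg (hy.trans_le hx).ne).trans (h.2 y hy)⟩

/-- A way of storing the elements of `Γ` in memory: in the variables below `bound` and in the
array cells `used`, where `(a, u, v)` is the cell `(u, v)` of array `a`. Variable `0` holds the
size, in which running times are measured. -/
structure Layout (Γ : Type*) where
  Rep : Γ → Memory → Prop
  size : Γ → ℕ
  bound : ℕ
  used : Γ → Set (ℕ × ℕ × ℕ)
  var_zero : ∀ {γ σ}, Rep γ σ → σ.var 0 = size γ
  congr : ∀ {γ σ τ}, Rep γ σ → (∀ x < bound, τ.var x = σ.var x) →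
    (∀ a u v, (a, u, v) ∈ used γ → τ.arr a u v = σ.arr a u v) → Rep γ τ

section Computes

variable {Γ : Type*} {K : Layout Γ}

theorem Layout.rep_of_agreesBelow {γ : Γ} {σ τ : Memory} {d : ℕ} (h : K.Rep γ σ)
    (hτ : σ.AgreesBelow d τ) (hd : K.bound ≤ d) : K.Rep γ τ :=
  K.congr h (hτ.mono hd).2 fun a u v _ => congrFun₃ hτ.1 a u v

/-- The layout that holds, in a further variable, an index below the size. -/
@[reducible] def Layout.push (K : Layout Γ) : Layout (Σ γ, Fin (K.size γ)) where
  Rep p σ := K.Rep p.1 σ ∧ σ.var K.bound = p.2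
  size p := K.size p.1
  bound := K.bound + 1
  used p := K.used p.1
  var_zero h := K.var_zero h.1
  congr h hvar harr := ⟨K.congr h.1 (fun x hx => hvar x (hx.trans K.bound.lt_succ_self)) harr,
    (hvar _ K.bound.lt_succ_self).trans h.2⟩

/-- `f` is computable in time polynomial in the size, with the result in any given variable `d`
outside the layout and the variables above `d` as workspace. -/
def Computes (K : Layout Γ) (f : Γ → ℕ) : Prop :=
  ∀ d, K.bound ≤ d → ∃ (prog : Program) (p : Polynomial ℕ), ∀ γ σ, K.Rep γ σ →
    prog.HaltsWithin (p.eval (K.size γ)) σ fun τ => σ.AgreesBelow d τ ∧ τ.var d = f γ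

theorem Computes.congr {f g : Γ → ℕ} (hf : Computes K f) (h : ∀ γ, f γ = g γ) : Computes K g :=
  (funext h : f = g) ▸ hf

theorem Computes.push {f : Γ → ℕ} (hf : Computes K f) : Computes K.push fun p => f p.1 := by
  intro d hd
  obtain ⟨prog, p, h⟩ := hf d (Nat.le_of_succ_le hd)
  exact ⟨prog, p, fun γ σ hσ => h γ.1 σ hσ.1⟩

theorem computes_of_expr {f : Γ → ℕ} (e : Expr) (he : ∀ γ σ, K.Rep γ σ → e.eval σ = f γ) :
    Computes K f := by
  refine fun d _ => ⟨.assign d e, .C (e.cost + 1), fun γ σ hσ => ?_⟩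
  rw [Polynomial.eval_C]
  exact haltsWithin_assign ⟨(Memory.AgreesBelow.refl d σ).setVar le_rfl _,
    (if_pos rfl).trans (he γ σ hσ)⟩

theorem computes_const (n : ℕ) : Computes K fun _ => n :=
  computes_of_expr (.const n) fun _ _ _ => rfl

theorem computes_index : Computes K.push fun p => (p.2 : ℕ) :=
  computes_of_expr (.var K.bound) fun _ _ h => h.2

theorem Computes.binary {f g r : Γ → ℕ} (hf : Computes K f) (hg : Computes K g) (e : ℕ → Expr)
    (he : ∀ d γ σ, K.Rep γ σ → σ.var d = f γ → σ.var (d + 1) = g γ → (e d).eval σ = r γ) :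
    Computes K r := by
  intro d hd
  obtain ⟨prog₁, p₁, h₁⟩ := hf d hd
  obtain ⟨prog₂, p₂, h₂⟩ := hg (d + 1) (hd.trans d.le_succ)
  refine ⟨.seq prog₁ (.seq prog₂ (.assign d (e d))), p₁ + (p₂ + .C ((e d).cost + 1)),
    fun γ σ hσ => ?_⟩
  rw [Polynomial.eval_add, Polynomial.eval_add, Polynomial.eval_C]
  refine (h₁ γ σ hσ).seq fun σ₁ ⟨hσ₁, hf₁⟩ => ?_
  have hrep₁ : K.Rep γ σ₁ := K.rep_of_agreesBelow hσ hσ₁ hd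
  refine (h₂ γ σ₁ hrep₁).seq fun σ₂ ⟨hσ₂, hg₂⟩ => haltsWithin_assign ⟨?_, ?_⟩
  · exact (hσ₁.trans (hσ₂.mono d.le_succ)).setVar le_rfl _
  · have hrep₂ : K.Rep γ σ₂ := K.rep_of_agreesBelow hrep₁ hσ₂ (hd.trans d.le_succ)
    exact (if_pos rfl).trans
      (he d γ σ₂ hrep₂ ((hσ₂.2 d d.lt_succ_self).trans hf₁) hg₂)

theorem Computes.add {f g : Γ → ℕ} (hf : Computes K f) (hg : Computes K g) :
    Computes K fun γ => f γ + g γ :=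
  hf.binary hg (fun d => .add (.var d) (.var (d + 1))) fun d γ σ _ h₁ h₂ => by
    simp only [Expr.eval, h₁, h₂]

theorem Computes.sum {f : ∀ γ, Fin (K.size γ) → ℕ} (hf : Computes K.push fun p => f p.1 p.2) :
    Computes K fun γ => ∑ i, f γ i := by
  intro d hd
  obtain ⟨prog, p, h⟩ := hf (d + 3) (by simp only; omega)
  let body : Program := .seq prog (.assign (d + 1) (.add (.var (d + 1)) (.var (d + 3))))
  refine ⟨.seq (.assign (d + 1) (.const 0))
    (.seq (.localForLoop K.bound (d + 2) body) (.assign d (.var (d + 1)))),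
    2 + (.X * (p + 4 + 8) + 10 + 2), fun γ σ hσ => ?_⟩
  simp only [Polynomial.eval_add, Polynomial.eval_mul, Polynomial.eval_X, Polynomial.eval_ofNat]
  let F : ℕ → ℕ := fun v => if hv : v < K.size γ then f γ ⟨v, hv⟩ else 0
  have hF : ∑ v ∈ Finset.range (K.size γ), F v = ∑ i, f γ i :=
    (Finset.sum_range F).trans <| Finset.sum_congr rfl fun i _ => dif_pos i.2
  let I : ℕ → Memory → Prop := fun k ρ => ρ.arr = σ.arr ∧
    ρ.var (d + 1) = ∑ v ∈ Finset.range k, F v ∧ ∀ x < d, x ≠ K.bound → ρ.var x = σ.var x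
  have hrep (k : ℕ) (ρ : Memory) (hρ : I k ρ) : K.Rep γ ρ :=
    K.congr hσ (fun x hx => hρ.2.2 x (by omega) (by omega)) fun a u v _ => congrFun₃ hρ.1 a u v
  have hbody (k : ℕ) (hk : k < K.size γ) (ρ : Memory) (hρ : I k ρ) (hρb : ρ.var K.bound = k) :
      body.HaltsWithin (p.eval (K.size γ) + 4) ρ
        fun τ => I (k + 1) τ ∧ τ.var K.bound = k ∧ τ.var (d + 2) = ρ.var (d + 2) := by
    refine (h ⟨γ, k, hk⟩ ρ ⟨hrep k ρ hρ, hρb⟩).seq fun τ ⟨⟨harr, hvar⟩, hval⟩ =>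
      haltsWithin_assign ⟨⟨harr.trans hρ.1, ?_, fun x hx hxb => ?_⟩, ?_, ?_⟩
    · have hFk : F k = f γ ⟨k, hk⟩ := dif_pos hk
      simp [Memory.setVar_var, Expr.eval, Finset.sum_range_succ, hval, hvar, hρ.2.1, hFk]
    all_goals rw [Memory.setVar_var, if_neg (by omega), hvar _ (by omega)]
    exacts [hρ.2.2 x hx hxb, hρb]
  refine .seq (haltsWithin_assign (Q := fun ρ => I 0 ρ ∧ ρ.var K.bound = σ.var K.bound)
    ⟨⟨rfl, if_pos rfl, fun x hx _ => if_neg (by omega)⟩, if_neg (by omega)⟩) fun σ₁ h₁ => .seq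
      (haltsWithin_localForLoop (by omega) (fun k ρ hρ => K.var_zero (hrep k ρ hρ)) ?_ hbody h₁.1)
      fun σ₂ h₂ => haltsWithin_assign
        ⟨⟨h₂.1.1, fun x hx => ?_⟩, (if_pos rfl).trans (h₂.1.2.1.trans hF)⟩
  · refine fun k ρ z v hz hρ => ⟨hρ.1, ?_, fun x hx hxb => ?_⟩ <;>
      rw [Memory.setVar_var, if_neg (by omega)]
    exacts [hρ.2.1, hρ.2.2 x hx hxb]
  · rw [Memory.setVar_var, if_neg hx.ne]
    by_cases hxb : x = K.bound
    exacts [hxb ▸ h₂.2.trans h₁.2, h₂.1.2.2 x hx hxb]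

end Computes

section Decides

variable {Γ : Type*} {K : Layout Γ} {P Q : Γ → Prop}

open scoped Classical in
/-- `P` is decidable in time polynomial in the size: its truth value, `1` or `0`, is computable. -/
def Decides (K : Layout Γ) (P : Γ → Prop) : Prop :=
  Computes K fun γ => if P γ then 1 else 0

theorem decides_iff [DecidablePred P] :
    Decides K P ↔ Computes K fun γ => if P γ then 1 else 0 := by
  rw [Decides]
  congr!

theorem Decides.congr (hP : Decides K P) (h : ∀ γ, P γ ↔ Q γ) : Decides K Q :=
  (funext fun γ => propext (h γ) : P = Q) ▸ hP

theorem Computes.decides_eq {f g : Γ → ℕ} (hf : Computes K f) (hg : Computes K g) :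
    Decides K fun γ => f γ = g γ :=
  decides_iff.2 <| hf.binary hg (fun d => .eq (.var d) (.var (d + 1))) fun d γ σ _ h₁ h₂ => by
    simp only [Expr.eval, h₁, h₂]

theorem Computes.decides_lt {f g : Γ → ℕ} (hf : Computes K f) (hg : Computes K g) :
    Decides K fun γ => f γ < g γ :=
  decides_iff.2 <| hf.binary hg (fun d => .lt (.var d) (.var (d + 1))) fun d γ σ _ h₁ h₂ => by
    simp only [Expr.eval, h₁, h₂]

theorem Decides.not (hP : Decides K P) : Decides K fun γ => ¬ P γ :=
  (Computes.decides_eq hP (computes_const 0)).congr fun γ => by simp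

theorem Decides.and (hP : Decides K P) (hQ : Decides K Q) : Decides K fun γ => P γ ∧ Q γ :=
  (Computes.decides_eq (Computes.add hP hQ) (computes_const 2)).congr fun γ => by
    split_ifs with h₁ h₂ h₂ <;> simp [h₁, h₂]

theorem Decides.or (hP : Decides K P) (hQ : Decides K Q) : Decides K fun γ => P γ ∨ Q γ :=
  (hP.not.and hQ.not).not.congr fun γ => by tauto

theorem Decides.imp (hP : Decides K P) (hQ : Decides K Q) : Decides K fun γ => P γ → Q γ :=
  (hP.not.or hQ).congr fun _ => imp_iff_not_or.symm

theorem Decides.card_filter {P : ∀ γ, Fin (K.size γ) → Prop} [∀ γ, DecidablePred (P γ)]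
    (hP : Decides K.push fun p => P p.1 p.2) :
    Computes K fun γ => (Finset.univ.filter (P γ)).card :=
  (Computes.sum (f := fun γ i => if P γ i then 1 else 0) (decides_iff.1 hP)).congr fun _ =>
    (Finset.card_filter _ _).symm

theorem Decides.forall {P : ∀ γ, Fin (K.size γ) → Prop}
    (hP : Decides K.push fun p => P p.1 p.2) : Decides K fun γ => ∀ i, P γ i := by
  classical
  have hcount := Decides.card_filter (P := fun γ i => ¬ P γ i) hP.not
  exact (hcount.decides_eq (computes_const 0)).congr fun γ => by simp [Finset.filter_eq_empty_iff]

theorem Decides.rowPermEquiv {β : Type*} {f g : ∀ γ, Fin (K.size γ) → β}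
    (hf : Decides K.push.push fun p => f p.1.1 p.2 = f p.1.1 p.1.2)
    (hg : Decides K.push.push fun p => g p.1.1 p.2 = f p.1.1 p.1.2) :
    Decides K fun γ => RowPermEquiv (f γ) (g γ) := by
  classical
  refine (Decides.forall ?_).congr fun γ => (rowPermEquiv_iff_card (f γ) (g γ)).symm
  exact (Decides.card_filter (K := K.push) hf).decides_eq (Decides.card_filter (K := K.push) hg)

end Decides

section Rename

variable {Γ : Type*} {K : Layout Γ}

theorem Computes.rename {β : Type*} [DecidableEq β]
    {T : ∀ γ, Fin (K.size γ) → Fin (K.size γ) → β} {i j : ∀ γ, Fin (K.size γ)}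
    (hij : Decides K.push.push.push.push fun p =>
      T p.1.1.1.1 p.1.2 p.2 = T p.1.1.1.1 (i p.1.1.1.1) (j p.1.1.1.1))
    (hT : Decides K.push.push.push.push fun p =>
      T p.1.1.1.1 p.1.2 p.2 = T p.1.1.1.1 p.1.1.1.2 p.1.1.2) :
    Computes K fun γ => GraphDyn.rename (T γ) (i γ) (j γ) := by
  classical
  let N (γ : Γ) (a b : Fin (K.size γ)) : Prop := ∀ a' b' : Fin (K.size γ),
    (a' : ℕ) < a ∨ (a' : ℕ) = a ∧ (b' : ℕ) < b + 1 → ¬ T γ a' b' = T γ (i γ) (j γ) ∧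
      (T γ a' b' = T γ a b → (a' : ℕ) = a ∧ (b' : ℕ) = b)
  have hN : Decides K.push.push fun p => N p.1.1 p.1.2 p.2 := by
    have ha := (computes_index (K := K)).push.push.push
    have hb := (computes_index (K := K.push)).push.push
    have ha' := (computes_index (K := K.push.push)).push
    have hb' := computes_index (K := K.push.push.push)
    refine .forall (.forall (.imp (.or ?_ (.and ?_ ?_)) (.and hij.not (.imp hT (.and ?_ ?_)))))
    · exact ha'.decides_lt ha
    · exact ha'.decides_eq ha
    · exact hb'.decides_lt (hb.add (computes_const 1))
    · exact ha'.decides_eq ha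
    · exact hb'.decides_eq hb
  refine (Computes.sum (f := fun γ a => (Finset.univ.filter (N γ a)).card)
    (Decides.card_filter (K := K.push) hN)).congr fun γ => ?_
  simp only [Finset.card_filter, ← Fintype.sum_prod_type', rename_apply]
  refine Finset.sum_congr rfl fun q _ => if_congr ?_ rfl rfl
  simp [N, Prod.Lex.toLex_le_toLex, Prod.ext_iff, Fin.ext_iff]

end Rename

section Matrices

variable {Γ : Type*} {K : Layout Γ}
  {H C : ∀ γ, Matrix (Fin (K.size γ)) (Fin (K.size γ)) ℕ} {i j i' j' : ∀ γ, Fin (K.size γ)}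

/-- The matrix `H γ` is available in an array. -/
def HoldsArray (K : Layout Γ) (H : ∀ γ, Matrix (Fin (K.size γ)) (Fin (K.size γ)) ℕ) : Prop :=
  ∃ a, ∀ γ σ, K.Rep γ σ → ∀ i j : Fin (K.size γ), σ.arr a i j = H γ i j

/-- The matrix `C γ` is available, row by row, in a single row of an array. -/
def HoldsRow (K : Layout Γ) (C : ∀ γ, Matrix (Fin (K.size γ)) (Fin (K.size γ)) ℕ) : Prop :=
  ∃ (a : ℕ) (e : Expr), ∀ γ σ, K.Rep γ σ →
    ∀ i j : Fin (K.size γ), σ.arr a (e.eval σ) (i * K.size γ + j) = C γ i j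

theorem HoldsArray.push (hH : HoldsArray K H) : HoldsArray K.push fun p => H p.1 :=
  hH.imp fun _ h p σ hσ => h p.1 σ hσ.1

theorem HoldsRow.push (hC : HoldsRow K C) : HoldsRow K.push fun p => C p.1 :=
  hC.imp fun _ => .imp fun _ h p σ hσ => h p.1 σ hσ.1

theorem HoldsArray.computes (hH : HoldsArray K H) (hi : Computes K fun γ => i γ)
    (hj : Computes K fun γ => j γ) : Computes K fun γ => H γ (i γ) (j γ) := by
  obtain ⟨a, h⟩ := hH
  exact hi.binary hj (fun d => .read a (.var d) (.var (d + 1))) fun d γ σ hσ h₁ h₂ => by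
    simp only [Expr.eval, h₁, h₂, h γ σ hσ]

theorem Computes.mul_size {f : Γ → ℕ} (hf : Computes K f) :
    Computes K fun γ => f γ * K.size γ :=
  (Computes.sum (f := fun γ _ => f γ) hf.push).congr fun γ => by simp [mul_comm]

theorem HoldsRow.computes (hC : HoldsRow K C) (hi : Computes K fun γ => i γ)
    (hj : Computes K fun γ => j γ) : Computes K fun γ => C γ (i γ) (j γ) := by
  obtain ⟨a, e, h⟩ := hC
  exact hi.mul_size.binary hj (fun d => .read a e (.add (.var d) (.var (d + 1))))
    fun d γ σ hσ h₁ h₂ => by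
    simp only [Expr.eval, h₁, h₂, h γ σ hσ]

theorem HoldsRow.decides_rowPermEquiv (hC : HoldsRow K C) (hi : Computes K fun γ => i γ)
    (hj : Computes K fun γ => j γ) : Decides K fun γ => RowPermEquiv (C γ (i γ)) (C γ (j γ)) := by
  have hC₂ := hC.push.push
  have hl : Computes K.push.push fun p => p.1.2 := computes_index.push
  have hl' : Computes K.push.push fun p => p.2 := computes_index
  exact .rowPermEquiv
    ((hC₂.computes hi.push.push hl').decides_eq (hC₂.computes hi.push.push hl))
    ((hC₂.computes hj.push.push hl').decides_eq (hC₂.computes hi.push.push hl))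

theorem HoldsRow.decides_distLabels_eq (hC : HoldsRow K C) (hi : Computes K fun γ => i γ)
    (hj : Computes K fun γ => j γ) (hi' : Computes K fun γ => i' γ)
    (hj' : Computes K fun γ => j' γ) :
    Decides K fun γ => distLabels (C γ) (i γ) (j γ) = distLabels (C γ) (i' γ) (j' γ) := by
  refine .congr (.rowPermEquiv (f := fun γ l => (C γ (i γ) l, C γ (j γ) l))
    (g := fun γ l => (C γ (i' γ) l, C γ (j' γ) l)) ?_ ?_) fun γ =>
    (distLabels_eq_iff (C γ) (i γ) (j γ) (i' γ) (j' γ)).symm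
  all_goals
    have hC₂ := hC.push.push
    have hl : Computes K.push.push fun p => p.1.2 := computes_index.push
    have hl' : Computes K.push.push fun p => p.2 := computes_index
    refine (Decides.and ?_ ?_).congr fun _ => Prod.mk_inj.symm
  · exact (hC₂.computes hi.push.push hl').decides_eq (hC₂.computes hi.push.push hl)
  · exact (hC₂.computes hj.push.push hl').decides_eq (hC₂.computes hj.push.push hl)
  · exact (hC₂.computes hi'.push.push hl').decides_eq (hC₂.computes hi.push.push hl)
  · exact (hC₂.computes hj'.push.push hl').decides_eq (hC₂.computes hj.push.push hl)

theorem HoldsRow.decides_tupleVector_eq (hC : HoldsRow K C) (hH : HoldsArray K H)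
    (hi : Computes K fun γ => i γ) (hj : Computes K fun γ => j γ)
    (hi' : Computes K fun γ => i' γ) (hj' : Computes K fun γ => j' γ) :
    Decides K fun γ =>
      tupleVector (H γ) (C γ) (i γ) (j γ) = tupleVector (H γ) (C γ) (i' γ) (j' γ) := by
  have hl : Computes K.push.push fun p => p.1.2 := computes_index.push
  have hl' : Computes K.push.push fun p => p.2 := computes_index
  have htuple {u u' v v' : ∀ γ, Fin (K.size γ)} (hu : Computes K fun γ => u γ)
      (hv : Computes K fun γ => v γ) (hu' : Computes K fun γ => u' γ)
      (hv' : Computes K fun γ => v' γ) : Decides K.push.push fun p =>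
      (C p.1.1 (u p.1.1) (v p.1.1), C p.1.1 p.2 (v p.1.1), distLabels (C p.1.1) (u p.1.1) p.2,
        H p.1.1 (u p.1.1) p.2) =
      (C p.1.1 (u' p.1.1) (v' p.1.1), C p.1.1 p.1.2 (v' p.1.1),
        distLabels (C p.1.1) (u' p.1.1) p.1.2, H p.1.1 (u' p.1.1) p.1.2) := by
    have hC₂ := hC.push.push
    simp only [Prod.mk_inj]
    refine .and ?_ (.and ?_ (.and ?_ ?_))
    · exact ((hC.computes hu hv).decides_eq (hC.computes hu' hv')).push.push
    · exact (hC₂.computes hl' hv.push.push).decides_eq (hC₂.computes hl hv'.push.push)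
    · exact hC₂.decides_distLabels_eq hu.push.push hl' hu'.push.push hl
    · exact (hH.push.push.computes hu.push.push hl').decides_eq
        (hH.push.push.computes hu'.push.push hl)
  exact (Decides.rowPermEquiv (htuple hi hj hi hj) (htuple hi' hj' hi hj)).congr fun γ =>
    (tupleVector_eq_iff (H γ) (C γ) (i γ) (j γ) (i' γ) (j' γ)).symm

theorem HoldsRow.computes_refine (hC : HoldsRow K C) (hH : HoldsArray K H)
    (hi : Computes K fun γ => i γ) (hj : Computes K fun γ => j γ) :
    Computes K fun γ => GraphDyn.refine (H γ) (C γ) (i γ) (j γ) := by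
  have hC₄ := hC.push.push.push.push
  have hH₄ := hH.push.push.push.push
  have ha : Computes K.push.push.push.push fun p => p.1.1.1.2 := computes_index.push.push.push
  have hb : Computes K.push.push.push.push fun p => p.1.1.2 := computes_index.push.push
  have ha' : Computes K.push.push.push.push fun p => p.1.2 := computes_index.push
  have hb' : Computes K.push.push.push.push fun p => p.2 := computes_index
  exact .rename (hC₄.decides_tupleVector_eq hH₄ ha' hb' hi.push.push.push.push
    hj.push.push.push.push) (hC₄.decides_tupleVector_eq hH₄ ha' hb' ha hb)

end Matrices

section Writes

open scoped Classical in
/-- The arrays that arise from `A` when the cells `S` of array `a` receive the values `g`. -/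
noncomputable def overwrite (A : ℕ → ℕ → ℕ → ℕ) (a : ℕ) (S : Set (ℕ × ℕ)) (g : ℕ × ℕ → ℕ) :
    ℕ → ℕ → ℕ → ℕ :=
  fun b u v => if b = a ∧ (u, v) ∈ S then g (u, v) else A b u v

variable {A : ℕ → ℕ → ℕ → ℕ} {a : ℕ} {g : ℕ × ℕ → ℕ}

theorem overwrite_of_mem {S : Set (ℕ × ℕ)} {u v : ℕ} (h : (u, v) ∈ S) :
    overwrite A a S g a u v = g (u, v) := if_pos ⟨rfl, h⟩

theorem overwrite_of_notMem {S : Set (ℕ × ℕ)} {b u v : ℕ} (h : b = a → (u, v) ∉ S) :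
    overwrite A a S g b u v = A b u v := if_neg fun h' => h h'.1 h'.2

theorem overwrite_empty : overwrite A a ∅ g = A := by
  funext b u v
  exact overwrite_of_notMem fun _ => Set.notMem_empty _

theorem overwrite_union (S S' : Set (ℕ × ℕ)) :
    overwrite (overwrite A a S g) a S' g = overwrite A a (S ∪ S') g := by
  funext b u v
  simp only [overwrite, Set.mem_union]
  grind

variable {Γ : Type*} {K : Layout Γ}

/-- The cells `S` of array `a` can be filled with the values `g` in time polynomial in the size. -/
def Writes (K : Layout Γ) (a : ℕ) (S : Γ → Set (ℕ × ℕ)) (g : Γ → ℕ × ℕ → ℕ) : Prop :=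
  ∀ d, K.bound ≤ d → ∃ (prog : Program) (p : Polynomial ℕ), ∀ γ σ, K.Rep γ σ →
    prog.HaltsWithin (p.eval (K.size γ)) σ fun τ =>
      (∀ x < d, τ.var x = σ.var x) ∧ τ.arr = overwrite σ.arr a (S γ) (g γ)

theorem Computes.writes {u v f : Γ → ℕ} (hu : Computes K u) (hv : Computes K v)
    (hf : Computes K f) {g : Γ → ℕ × ℕ → ℕ} (hg : ∀ γ, g γ (u γ, v γ) = f γ) :
    Writes K a (fun γ => {(u γ, v γ)}) g := by
  intro d hd
  obtain ⟨prog₁, p₁, h₁⟩ := hu d hd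
  obtain ⟨prog₂, p₂, h₂⟩ := hv (d + 1) (by omega)
  obtain ⟨prog₃, p₃, h₃⟩ := hf (d + 2) (by omega)
  refine ⟨.seq prog₁ (.seq prog₂ (.seq prog₃ (.store a (.var d) (.var (d + 1)) (.var (d + 2))))),
    p₁ + (p₂ + (p₃ + 4)), fun γ σ hσ => ?_⟩
  simp only [Polynomial.eval_add, Polynomial.eval_ofNat]
  refine (h₁ γ σ hσ).seq fun σ₁ ⟨hσ₁, hval₁⟩ => ?_
  have hrep₁ := K.rep_of_agreesBelow hσ hσ₁ hd
  refine (h₂ γ σ₁ hrep₁).seq fun σ₂ ⟨hσ₂, hval₂⟩ => ?_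
  have hrep₂ := K.rep_of_agreesBelow hrep₁ hσ₂ (by omega)
  refine (h₃ γ σ₂ hrep₂).seq fun σ₃ ⟨hσ₃, hval₃⟩ => haltsWithin_store ⟨?_, ?_⟩
  · exact ((hσ₁.trans (hσ₂.mono (by omega))).trans (hσ₃.mono (by omega))).2
  · have hu₃ : σ₃.var d = u γ := by rw [hσ₃.2 d (by omega), hσ₂.2 d (by omega), hval₁]
    have hv₃ : σ₃.var (d + 1) = v γ := by rw [hσ₃.2 (d + 1) (by omega), hval₂]
    funext b x y
    simp only [Memory.setArr, overwrite, Expr.eval, hu₃, hv₃, hval₃, hσ₃.1, hσ₂.1, hσ₁.1,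
      Set.mem_singleton_iff, Prod.mk.injEq]
    split_ifs with h
    exacts [by rw [h.2.1, h.2.2, hg], rfl]

theorem Writes.forEach {S : ∀ γ, Fin (K.size γ) → Set (ℕ × ℕ)} {g : Γ → ℕ × ℕ → ℕ}
    (h : Writes K.push a (fun p => S p.1 p.2) fun p => g p.1)
    (hused : ∀ γ i, ∀ q ∈ S γ i, (a, q) ∉ K.used γ) : Writes K a (fun γ => ⋃ i, S γ i) g := by
  intro d hd
  obtain ⟨prog, p, h⟩ := h (d + 2) (by simp only; omega)
  refine ⟨.localForLoop K.bound (d + 1) prog, .X * (p + 8) + 10, fun γ σ hσ => ?_⟩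
  simp only [Polynomial.eval_add, Polynomial.eval_mul, Polynomial.eval_X, Polynomial.eval_ofNat]
  let U : ℕ → Set (ℕ × ℕ) := fun k => ⋃ i : Fin (K.size γ), ⋃ _ : (i : ℕ) < k, S γ i
  let I : ℕ → Memory → Prop := fun k ρ =>
    (∀ x < d, x ≠ K.bound → ρ.var x = σ.var x) ∧ ρ.arr = overwrite σ.arr a (U k) (g γ)
  have hU₀ : U 0 = ∅ := by simp [U]
  have hU (k : ℕ) (hk : k < K.size γ) : U k ∪ S γ ⟨k, hk⟩ = U (k + 1) := by
    ext q
    simp only [U, Set.mem_union, Set.mem_iUnion, Nat.lt_succ_iff_lt_or_eq]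
    constructor
    · rintro (⟨i, hi, hq⟩ | hq)
      exacts [⟨i, .inl hi, hq⟩, ⟨⟨k, hk⟩, .inr rfl, hq⟩]
    · rintro ⟨i, hi | rfl, hq⟩
      exacts [.inl ⟨i, hi, hq⟩, .inr hq]
  have hUn : U (K.size γ) = ⋃ i, S γ i := by simp [U]
  have hrep (k : ℕ) (ρ : Memory) (hρ : I k ρ) : K.Rep γ ρ := by
    refine K.congr hσ (fun x hx => hρ.1 x (by omega) (by omega)) fun b u v hb => ?_
    rw [hρ.2]
    refine overwrite_of_notMem ?_
    rintro rfl hmem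
    simp only [U, Set.mem_iUnion] at hmem
    obtain ⟨i, _, hi⟩ := hmem
    exact hused γ i _ hi hb
  refine (haltsWithin_localForLoop (I := I) (T := p.eval (K.size γ)) (y := d + 1) (by omega)
    (fun k ρ hρ => K.var_zero (hrep k ρ hρ)) (fun k ρ z v hz hρ => ⟨fun x hx hxb => ?_, hρ.2⟩)
    (fun k hk ρ hρ hρb => ?_) ⟨fun _ _ _ => rfl, by rw [hU₀, overwrite_empty]⟩).mono le_rfl
    fun τ hτ => ⟨fun x hx => ?_, hUn ▸ hτ.1.2⟩
  · exact (if_neg (by omega)).trans (hρ.1 x hx hxb)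
  · refine (h ⟨γ, k, hk⟩ ρ ⟨hrep k ρ hρ, hρb⟩).mono le_rfl fun τ ⟨hvar, harr⟩ =>
      ⟨⟨fun x hx hxb => (hvar x (by omega)).trans (hρ.1 x hx hxb), ?_⟩,
        (hvar _ (by omega)).trans hρb, hvar _ (by omega)⟩
    rw [harr, hρ.2, overwrite_union, hU k hk]
  · by_cases hxb : x = K.bound
    exacts [hxb ▸ hτ.2, hτ.1.1 x hx hxb]

theorem Computes.exists_fill_program {u v f : ∀ γ, Fin (K.size γ) → Fin (K.size γ) → ℕ}
    (hu : Computes K.push.push fun p => u p.1.1 p.1.2 p.2)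
    (hv : Computes K.push.push fun p => v p.1.1 p.1.2 p.2)
    (hf : Computes K.push.push fun p => f p.1.1 p.1.2 p.2)
    (hinj : ∀ γ i j i' j', u γ i j = u γ i' j' → v γ i j = v γ i' j' → i = i' ∧ j = j')
    (hused : ∀ γ i j, (a, u γ i j, v γ i j) ∉ K.used γ) :
    ∃ (prog : Program) (p : Polynomial ℕ), ∀ γ σ, K.Rep γ σ →
      prog.HaltsWithin (p.eval (K.size γ)) σ fun τ => (∀ x < K.bound, τ.var x = σ.var x) ∧
        (∀ i j, τ.arr a (u γ i j) (v γ i j) = f γ i j) ∧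
        ∀ b x y, (b = a → ∀ i j, x = u γ i j → y ≠ v γ i j) → τ.arr b x y = σ.arr b x y := by
  let cell (γ : Γ) (q : Fin (K.size γ) × Fin (K.size γ)) : ℕ × ℕ := (u γ q.1 q.2, v γ q.1 q.2)
  have hcell (γ : Γ) : (cell γ).Injective := fun q q' h =>
    Prod.ext_iff.2 (hinj γ _ _ _ _ (congrArg Prod.fst h) (congrArg Prod.snd h))
  let g (γ : Γ) : ℕ × ℕ → ℕ := Function.extend (cell γ) (fun q => f γ q.1 q.2) 0
  have hg (γ : Γ) (i j : Fin (K.size γ)) : g γ (u γ i j, v γ i j) = f γ i j :=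
    (hcell γ).extend_apply _ _ (i, j)
  have hentry : Writes K.push.push a (fun p => {(u p.1.1 p.1.2 p.2, v p.1.1 p.1.2 p.2)})
      fun p => g p.1.1 := hu.writes hv hf fun p => hg p.1.1 p.1.2 p.2
  have hrow : Writes K.push a (fun p => ⋃ j, {(u p.1 p.2 j, v p.1 p.2 j)}) fun p => g p.1 :=
    hentry.forEach fun p j q hq => hq ▸ hused p.1 p.2 j
  have hall : Writes K a (fun γ => ⋃ i, ⋃ j, {(u γ i j, v γ i j)}) g :=
    .forEach (S := fun γ i => ⋃ j, {(u γ i j, v γ i j)}) hrow fun γ i q hq => by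
      obtain ⟨j, hj⟩ := Set.mem_iUnion.1 hq
      exact hj ▸ hused γ i j
  obtain ⟨prog, p, h⟩ := hall K.bound le_rfl
  refine ⟨prog, p, fun γ σ hσ => (h γ σ hσ).mono le_rfl fun τ ⟨hvar, harr⟩ =>
    ⟨hvar, fun i j => ?_, fun b x y hne => ?_⟩⟩
  · rw [harr, overwrite_of_mem, hg]
    simp only [Set.mem_iUnion]
    exact ⟨i, j, rfl⟩
  · rw [harr]
    refine overwrite_of_notMem fun hb hmem => ?_
    simp only [Set.mem_iUnion, Set.mem_singleton_iff, Prod.mk.injEq] at hmem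
    obtain ⟨i, j, hx, hy⟩ := hmem
    exact hne hb i j hx hy

end Writes

/-! ### The program of the algorithm -/

section Runs

theorem eq_and_eq_of_mul_add_eq {m : ℕ} {i j i' j' : Fin m}
    (h : (i : ℕ) * m + j = i' * m + j') : i = i' ∧ j = j' := by
  have hm : 0 < m := i.pos
  have hdiv := congrArg (· / m) h
  have hmod := congrArg (· % m) h
  simp only [Nat.mul_add_mod', Nat.mod_eq_of_lt j.2, Nat.mod_eq_of_lt j'.2] at hmod
  simp only [mul_comm _ m, Nat.mul_add_div hm, Nat.div_eq_of_lt j.2, Nat.div_eq_of_lt j'.2,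
    add_zero] at hdiv
  exact ⟨Fin.ext hdiv, Fin.ext hmod⟩

/-- A graph with a step of the algorithm: what the memory is about during a run. -/
structure Run where
  {size : ℕ}
  graph : SimpleGraph (Fin size)
  [dec : DecidableRel graph.Adj]
  step : ℕ

attribute [instance] Run.dec

/-- The memory during a run on `G`, in step `s`: variable `1` holds `s`, and the matrices `C^{s'}`
with `s' < r` are available, stored as in `HoldsOutput`. -/
structure HoldsRun {m : ℕ} (G : SimpleGraph (Fin m)) [DecidableRel G.Adj] (s r : ℕ) (σ : Memory) :
    Prop where
  var_zero : σ.var 0 = m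
  var_one : σ.var 1 = s
  adj : ∀ i j : Fin m, σ.arr 0 i j = G.adjMatrix ℕ i j
  labels : ∀ s' < r, ∀ i j : Fin m, σ.arr 1 s' (i * m + j) = labels G s' i j

section

variable {m : ℕ} {G : SimpleGraph (Fin m)} [DecidableRel G.Adj] {s r : ℕ}

theorem HoldsRun.congr {σ τ : Memory} (h : HoldsRun G s r σ) (hvar : ∀ x < 2, τ.var x = σ.var x)
    (harr₀ : ∀ u v, τ.arr 0 u v = σ.arr 0 u v)
    (harr₁ : ∀ s' < r, ∀ v, τ.arr 1 s' v = σ.arr 1 s' v) :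
    HoldsRun G s r τ where
  var_zero := (hvar 0 two_pos).trans h.var_zero
  var_one := (hvar 1 one_lt_two).trans h.var_one
  adj i j := (harr₀ i j).trans (h.adj i j)
  labels s' hs' i j := (harr₁ s' hs' _).trans (h.labels s' hs' i j)

theorem holdsRun_inputMemory : HoldsRun G 0 0 (inputMemory G) where
  var_zero := rfl
  var_one := rfl
  adj i j := dif_pos ⟨rfl, i.2, j.2⟩
  labels s' hs' := absurd hs' s'.not_lt_zero

end

/-- The layout of a run in which the matrices `C^{s'}` with `s' < step + k` are available. -/
@[reducible] def runLayout (k : ℕ) : Layout Run where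
  Rep γ := HoldsRun γ.graph γ.step (γ.step + k)
  size γ := γ.size
  bound := 2
  used γ := {c | c.1 = 0 ∨ c.1 = 1 ∧ c.2.1 < γ.step + k}
  var_zero h := h.var_zero
  congr h hvar harr :=
    h.congr hvar (fun u v => harr 0 u v (.inl rfl)) fun s' hs' v => harr 1 s' v (.inr ⟨rfl, hs'⟩)

theorem holdsRow_runLayout {k r : ℕ} (hr : r < k) :
    HoldsRow (runLayout k) fun γ => labels γ.graph (γ.step + r) :=
  ⟨1, .add (.var 1) (.const r), fun γ σ hσ i j => by
    simp only [Expr.eval, hσ.var_one, hσ.labels (γ.step + r) (by omega)]⟩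

theorem holdsArray_runLayout (k : ℕ) :
    HoldsArray (runLayout k) fun γ => γ.graph.adjMatrix ℕ :=
  ⟨0, fun _ _ hσ => hσ.adj⟩

theorem exists_append_program {k : ℕ} {f : ∀ γ : Run, Fin γ.size → Fin γ.size → ℕ}
    (hf : Computes (runLayout k).push.push fun p => f p.1.1 p.1.2 p.2) :
    ∃ (prog : Program) (p : Polynomial ℕ), ∀ {m : ℕ} (G : SimpleGraph (Fin m)) [DecidableRel G.Adj]
      (s : ℕ) (σ : Memory), HoldsRun G s (s + k) σ → f ⟨G, s⟩ = labels G (s + k) →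
      prog.HaltsWithin (p.eval m) σ (HoldsRun G s (s + k + 1)) := by
  have hrow : Computes (runLayout k) fun γ => γ.step + k :=
    computes_of_expr (.add (.var 1) (.const k)) fun γ σ hσ => by
      simp only [Expr.eval, hσ.var_one]
  have hcell : Computes (runLayout k).push.push fun p => p.1.2 * p.1.1.size + p.2 :=
    computes_index.push.mul_size.add computes_index
  obtain ⟨prog, p, h⟩ := Computes.exists_fill_program (a := 1) (u := fun γ _ _ => γ.step + k)
    (v := fun γ i j => i * γ.size + j) hrow.push.push hcell hf
    (fun γ i j i' j' _ h => eq_and_eq_of_mul_add_eq h) fun γ i j => by simp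
  refine ⟨prog, p, fun G _ s σ hσ hlabels => (h ⟨G, s⟩ σ hσ).mono le_rfl
    fun τ ⟨hvar, hnew, hold⟩ => ?_⟩
  have hτ : HoldsRun G s (s + k) τ :=
    hσ.congr hvar (fun u v => hold 0 u v fun h => absurd h zero_ne_one)
      fun s' hs' v => hold 1 s' v fun _ _ _ h => absurd h hs'.ne
  refine { hτ with labels := fun s' hs' i j => ?_ }
  rcases Nat.lt_succ_iff_lt_or_eq.1 hs' with hlt | rfl
  exacts [hτ.labels s' hlt i j, (hnew i j).trans (congrFun₂ hlabels i j)]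

theorem exists_start_program : ∃ (prog : Program) (p : Polynomial ℕ), ∀ {m : ℕ}
    (G : SimpleGraph (Fin m)) [DecidableRel G.Adj],
    prog.HaltsWithin (p.eval m) (inputMemory G) (HoldsRun G 0 1) := by
  have hindex : Decides (runLayout 0).push.push fun p => (p.1.2 : ℕ) = p.2 :=
    computes_index.push.decides_eq computes_index
  obtain ⟨prog, p, h⟩ := exists_append_program (f := fun _ i j => if (i : ℕ) = j then 0 else 1)
    ((decides_iff.1 hindex.not).congr fun p => ite_not _ _ _)
  refine ⟨prog, p, fun G _ => h G 0 _ holdsRun_inputMemory ?_⟩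
  simp only [← Fin.ext_iff]
  rfl

theorem exists_refine_program : ∃ (prog : Program) (p : Polynomial ℕ), ∀ {m : ℕ}
    (G : SimpleGraph (Fin m)) [DecidableRel G.Adj] (s : ℕ) (σ : Memory), HoldsRun G s (s + 1) σ →
    prog.HaltsWithin (p.eval m) σ (HoldsRun G s (s + 2)) := by
  obtain ⟨prog, p, h⟩ := exists_append_program
    (f := fun γ => GraphDyn.refine (γ.graph.adjMatrix ℕ) (labels γ.graph γ.step))
    ((holdsRow_runLayout one_pos).push.push.computes_refine (holdsArray_runLayout 1).push.push
      computes_index.push computes_index)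
  exact ⟨prog, p, fun G _ s σ hσ => h G s σ hσ rfl⟩

theorem exists_step_program : ∃ (prog : Program) (p : Polynomial ℕ), ∀ {m : ℕ}
    (G : SimpleGraph (Fin m)) [DecidableRel G.Adj] (s : ℕ) (σ : Memory), HoldsRun G s (s + 1) σ →
    prog.HaltsWithin (p.eval m) σ fun τ =>
      HoldsRun G s (s + 2) τ ∧ (τ.var 2 = 0 ↔ labels G s = labels G (s + 1)) := by
  obtain ⟨prog₁, p₁, h₁⟩ := exists_refine_program
  have hstable : Decides (runLayout 2) fun γ =>
      labels γ.graph γ.step = labels γ.graph (γ.step + 1) := by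
    simp only [← Matrix.ext_iff]
    refine .forall (.forall (Computes.decides_eq ?_ ?_))
    exacts [(holdsRow_runLayout two_pos).push.push.computes computes_index.push computes_index,
      (holdsRow_runLayout one_lt_two).push.push.computes computes_index.push computes_index]
  obtain ⟨prog₂, p₂, h₂⟩ := hstable.not 2 le_rfl
  refine ⟨.seq prog₁ prog₂, p₁ + p₂, fun G _ s σ hσ => ?_⟩
  rw [Polynomial.eval_add]
  refine (h₁ G s σ hσ).seq fun τ hτ => (h₂ ⟨G, s⟩ τ hτ).mono le_rfl fun ρ ⟨hρ, hval⟩ => ⟨?_, ?_⟩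
  · exact (runLayout 2).rep_of_agreesBelow (γ := ⟨G, s⟩) hτ hρ le_rfl
  · rw [hval]
    simp

theorem exists_partition_program : ∃ (prog : Program) (p : Polynomial ℕ), ∀ {m : ℕ}
    (G : SimpleGraph (Fin m)) [DecidableRel G.Adj] (N : ℕ) (σ : Memory), StopsAt G N → N ≤ m ^ 2 →
    HoldsRun G N (N + 2) σ → prog.HaltsWithin (p.eval m) σ (HoldsOutput G) := by
  classical
  have hclass : Decides (runLayout 2).push.push fun p =>
      RowPermEquiv (labels p.1.1.graph p.1.1.step p.1.2) (labels p.1.1.graph p.1.1.step p.2) :=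
    (holdsRow_runLayout two_pos).push.push.decides_rowPermEquiv computes_index.push computes_index
  obtain ⟨prog, p, h⟩ := Computes.exists_fill_program (K := runLayout 2) (a := 2)
    (u := fun _ i _ => i) (v := fun _ _ j => j)
    (f := fun γ i j => if RowPermEquiv (labels γ.graph γ.step i) (labels γ.graph γ.step j)
      then 1 else 0)
    computes_index.push computes_index (decides_iff.1 hclass)
    (fun γ i j i' j' hi hj => ⟨Fin.ext hi, Fin.ext hj⟩) fun γ i j => by
      rintro (h | h) <;> simp at h
  refine ⟨prog, p, fun G _ N σ hN hle hσ => (h ⟨G, N⟩ σ hσ).mono le_rfl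
    fun τ ⟨hvar, hnew, hold⟩ => ?_⟩
  have hτ : HoldsRun G N (N + 2) τ :=
    hσ.congr hvar (fun u v => hold 0 u v fun h => absurd h (by decide))
      fun s' _ v => hold 1 s' v fun h => absurd h (by decide)
  have hclasses (i j : Fin _) : τ.arr 2 i j = if SameClassA1' G i j then 1 else 0 := by
    rw [hnew, sameClassA1'_iff hN hle]
  rw [HoldsOutput, hτ.var_one]
  exact ⟨hN, fun s hs => hτ.labels s (by omega), fun i j h => (hclasses i j).trans (if_pos h),
    fun i j h => (hclasses i j).trans (if_neg h)⟩

theorem exists_program : ∃ (prog : Program) (p : Polynomial ℕ), ∀ (m : ℕ)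
    (G : SimpleGraph (Fin m)) [DecidableRel G.Adj],
    prog.HaltsWithin (p.eval m) (inputMemory G) (HoldsOutput G) := by
  obtain ⟨start, p₁, hstart⟩ := exists_start_program
  obtain ⟨step, p₂, hstep⟩ := exists_step_program
  obtain ⟨final, p₃, hfinal⟩ := exists_partition_program
  let body : Program := .seq (.assign 1 (.add (.var 1) (.const 1))) step
  refine ⟨.seq start (.seq step (.seq (.loop (.var 2) body) final)),
    p₁ + (p₂ + (.X ^ 2 * (2 + (4 + p₂)) + 2 + p₃)), fun m G _ => ?_⟩
  obtain ⟨N, hN, hcount⟩ := exists_stopsAt G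
  have hle : N ≤ m ^ 2 := le_of_add_le_right hcount
  let I : ℕ → Memory → Prop := fun k σ =>
    HoldsRun G k (k + 2) σ ∧ (σ.var 2 = 0 ↔ labels G k = labels G (k + 1))
  have hbody (k : ℕ) (hk : k < N) (σ : Memory) (hσ : I k σ) :
      σ.var 2 ≠ 0 ∧ body.HaltsWithin (4 + p₂.eval m) σ (I (k + 1)) := by
    refine ⟨fun h => hk.not_ge (hN.2 (hσ.2.1 h)), .seq (haltsWithin_assign (Q :=
      HoldsRun G (k + 1) (k + 2)) ?_) fun τ hτ => hstep G (k + 1) τ hτ⟩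
    exact { hσ.1 with var_one := by simp [Memory.setVar_var, Expr.eval, hσ.1.var_one] }
  have hloop (σ : Memory) (hσ : I 0 σ) :=
    haltsWithin_loop (e := .var 2) hbody (fun τ hτ => hτ.2.2 hN.1) hσ
  refine ((hstart G).seq fun σ₁ h₁ => (hstep G 0 σ₁ h₁).seq fun σ₂ h₂ => (hloop σ₂ h₂).seq
    fun σ₃ h₃ => hfinal G N σ₃ hN hle h₃.1).mono ?_ fun _ h => h
  simp only [Polynomial.eval_add, Polynomial.eval_mul, Polynomial.eval_pow, Polynomial.eval_X,
    Polynomial.eval_ofNat, Expr.cost, one_add_one_eq_two]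
  gcongr

end Runs

end GraphDyn

open GraphDyn in
theorem theorem6 :
    -- A1' is polynomial in the number `m` of vertices
    (∃ (prog : Program) (p : Polynomial ℕ),
      ∀ (m : ℕ) (G : SimpleGraph (Fin m)) [DecidableRel G.Adj],
        ∃ (t : ℕ) (σ : Memory),
          Exec prog (inputMemory G) t σ ∧ t ≤ p.eval m ∧ HoldsOutput G σ) ∧
    ∀ (m : ℕ) (_ : 0 < m) (G : SimpleGraph (Fin m)) [DecidableRel G.Adj],
      -- A1' computes `C^1, …, C^{N+1}` and stops, after `N + 1 ≤ m ^ 2` steps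
      (∃ N : ℕ, StopsAt G N ∧ N + 1 ≤ m ^ 2 ∧ ∀ s, N ≤ s → labels G s = labels G N) ∧
      -- automorphism equivalent vertices are never separated by A1'
      (∀ i j : Fin m, (∃ φ : G ≃g G, φ i = j) → SameClassA1' G i j) ∧
      ∀ (J : Set ℝ) (_ : IsOpen J) (_ : J.OrdConnected) (_ : (0 : ℝ) ∈ J)
        (X : ℝ → Matrix (Fin m) (Fin m) ℝ) (_ : IsSolution G J X),
        -- different components of the solution are separated by the labels
        (∀ i r j s : Fin m, (∃ t ∈ J, X t i r ≠ X t j s) →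
          ∃ k ≤ m ^ 2, labels G k i r ≠ labels G k j s) ∧
        -- A1 is covered by A1'
        (∀ i j : Fin m, SameClassA1' G i j → SameClassA1 X i j) := by
  refine ⟨exists_program, fun m hm G _ => ?_⟩
  obtain ⟨N, hN, hcount⟩ := exists_stopsAt G
  have hpos : 0 < labelCount G 0 := labelCount_pos hm 0
  refine ⟨⟨N, hN, by omega, fun s => hN.eq⟩, fun i j => sameClassA1'_of_automorphism,
    fun J hJ hJc h0 X hX => ?_⟩
  have hle : N ≤ m ^ 2 := by omega
  have heq {i r j s : Fin m} (h : labels G N i r = labels G N j s) (t : ℝ) (ht : t ∈ J) :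
      X t i r = X t j s := solution_mem_labelSubspace hN hJ hJc h0 hX t ht i r j s h
  refine ⟨fun i r j s ⟨t, ht, hne⟩ => ⟨N, hle, fun h => hne (heq h t ht)⟩, fun i j hij n _ => ?_⟩
  obtain ⟨π, hπ⟩ := hij N hle
  refine ⟨π, fun l => ?_⟩
  have hev : (fun t => X t i (π l)) =ᶠ[nhds 0] fun t => X t j l :=
    Filter.eventually_of_mem (hJ.mem_nhds h0) (heq (hπ l))
  rw [coeffMatrix, coeffMatrix, hev.iteratedDeriv_eq]
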